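/- A *nondegenerate* 0-1 matrix is a square matrix $A=(a_{ij})$ of size $n\ge 1$ with entries in $\{0,1\}$ no row and no column of which is zero; let $\mathcal N$ be the set of all of them, of all sizes. For $B\in\mathcal N$ of size $n$ and $C\in\mathcal N$ of size $m$, the Kronecker product $B\boxtimes C\in\mathcal N$ is the matrix of size $nm$ with $(B\boxtimes C)_{m(i-1)+j,\;m(i'-1)+j'}=b_{ii'}c_{jj'}$. For $A\in\mathcal N$ of size $n$, the Cuntz–Krieger algebra $\mathcal O_A$ is the universal unital C*-algebra generated by partial isometries $s_1,\dots,s_n$ with $$s_i^*s_i=\sum_{j=1}^n a_{ij}\,s_js_j^*\quad(i=1,\dots,n),\qquad \sum_{i=1}^n s_is_i^*=1,$$ except that for the matrix $A=1$ of size one, by convention, $\mathcal O_1=\mathbb C$ with generator $s_1=1$. All tensor products of C*-algebras are minimal, and those of *-homomorphisms are the induced maps. Let $$CK_*=\bigoplus_{A\in\mathcal N}\mathcal O_A$$ be the C*-algebra of all families $(x_A)_{A}$, $x_A\in\mathcal O_A$, such that for every $\epsilon>0$ only finitely many $A$ satisfy $\|x_A\|\ge\epsilon$, with the supremum norm. For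 $B,C\in\mathcal N$, with $m$ the size of $C$, there is a unique unital *-homomorphism $$\varphi_{B,C}:\mathcal O_{B\boxtimes C}\to\mathcal O_B\otimes\mathcal O_C,\qquad \varphi_{B,C}(s_{m(i-1)+j})=s_i\otimes s_j .$$ For $A\in\mathcal N$ the set $\mathcal N_A=\{(B,C)\in\mathcal N^2: B\boxtimes C=A\}$ is finite. Let $\Delta_\varphi:CK_*\to CK_*\otimes CK_*$ be the *-homomorphism with $$\Delta_\varphi(x)=\sum_{(B,C)\in\mathcal N_A}\varphi_{B,C}(x)\qquad(x\in\mathcal O_A,\ A\in\mathcal N),$$ where $\mathcal O_B\otimes\mathcal O_C$ is regarded as a subalgebra of $CK_*\otimes CK_*$, and let $\varepsilon:CK_*\to\mathbb C$ be the *-homomorphism that is $0$ on $\mathcal O_A$ for $A\ne 1$ and the identity on $\mathcal O_1=\mathbb C$. **Theorem 1.1.** $(CK_*,\Delta_\varphi,\varepsilon)$ is a counital, strictly proper, nonunital C*-bialgebra. That is: 1. the linear span of $\{\Delta_\varphi(a)(b\otimes c): a,b,c\in CK_*\}$ is dense in $CK_*\otimes CK_*$; 2. $(\Delta_\varphi\otimes\mathrm{id})\circ\Delta_\varphi=(\mathrm{id}\otimes\Delta_\varphi)\circ\Delta_\varphi$,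 where $(CK_*\otimes CK_*)\otimes CK_*$ and $CK_*\otimes(CK_*\otimes CK_*)$ are identified through the *-isomorphism with $(a\otimes b)\otimes c\mapsto a\otimes(b\otimes c)$; 3. $(\varepsilon\otimes\mathrm{id})(\Delta_\varphi(x))=1\otimes x$ in $\mathbb C\otimes CK_*$ and $(\mathrm{id}\otimes\varepsilon)(\Delta_\varphi(x))=x\otimes 1$ in $CK_*\otimes\mathbb C$ for all $x\in CK_*$; 4. $CK_*$ has no unit. ("Strictly proper" means that $\Delta_\varphi$ takes its values in $CK_*\otimes CK_*$ and not only in its multiplier algebra.) -/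

import Mathlib

open scoped TensorProduct ENNReal Topology
open Filter

noncomputable section

universe u v w

/-! ### The C*-algebra obtained from a C*-seminorm on a complex `*`-algebra -/

/-- A C*-seminorm on a (not necessarily unital) complex `*`-algebra. -/
structure CStarSeminorm (𝔄 : Type u) [NonUnitalRing 𝔄] [StarRing 𝔄] [Module ℂ 𝔄]
    extends Seminorm ℂ 𝔄 where
  mul_le' : ∀ x y, toFun (x * y) ≤ toFun x * toFun y
  sq_le' : ∀ x, toFun x * toFun x ≤ toFun (star x * x)

namespace CStarSeminorm

variable {𝔄 : Type u} [NonUnitalRing 𝔄] [StarRing 𝔄] [Module ℂ 𝔄]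

/-- The C*-seminorm `x ↦ sup_i ‖f i x‖` of a nonempty, pointwise bounded family of
`*`-homomorphisms into C*-algebras. -/
def ofHoms {ι : Type v} [Nonempty ι] {D : ι → Type w} [∀ i, NonUnitalCStarAlgebra (D i)]
    (f : ∀ i, 𝔄 →⋆ₙₐ[ℂ] D i) (hbdd : ∀ x, ∃ C, ∀ i, ‖f i x‖ ≤ C) : CStarSeminorm 𝔄 :=
  have hb : ∀ x, BddAbove (Set.range fun i => ‖f i x‖) := fun x => by
    obtain ⟨C, hC⟩ := hbdd x
    exact ⟨C, by rintro _ ⟨i, rfl⟩; exact hC i⟩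
  have hle : ∀ i x, ‖f i x‖ ≤ ⨆ j, ‖f j x‖ := fun i x => le_ciSup (hb x) i
  have hnn : ∀ x, 0 ≤ ⨆ j, ‖f j x‖ := fun x => Real.iSup_nonneg fun i => norm_nonneg _
  { Seminorm.ofSMulLE (𝕜 := ℂ) (fun x => ⨆ i, ‖f i x‖) (by simp)
      (fun x y => ciSup_le fun i => by
        rw [map_add]; exact (norm_add_le _ _).trans (add_le_add (hle i x) (hle i y)))
      (fun c x => ciSup_le fun i => by
        rw [map_smul, norm_smul]; exact mul_le_mul_of_nonneg_left (hle i x) (norm_nonneg c)) with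
    mul_le' := fun x y => ciSup_le fun i => by
      rw [map_mul]
      exact (norm_mul_le _ _).trans (mul_le_mul (hle i x) (hle i y) (norm_nonneg _) (hnn x))
    sq_le' := fun x => by
      change (⨆ i, ‖f i x‖) * (⨆ i, ‖f i x‖) ≤ ⨆ i, ‖f i (star x * x)‖
      have h1 : (⨆ i, ‖f i x‖) ≤ Real.sqrt (⨆ i, ‖f i (star x * x)‖) :=
        ciSup_le fun i => Real.le_sqrt_of_sq_le (by
          rw [pow_two, ← CStarRing.norm_star_mul_self, ← map_star, ← map_mul]; exact hle i _)
      calc (⨆ i, ‖f i x‖) * (⨆ i, ‖f i x‖)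
          ≤ Real.sqrt (⨆ i, ‖f i (star x * x)‖) * Real.sqrt (⨆ i, ‖f i (star x * x)‖) :=
            mul_self_le_mul_self (hnn x) h1
        _ = _ := Real.mul_self_sqrt (hnn _) }

theorem ofHoms_apply {ι : Type v} [Nonempty ι] {D : ι → Type w} [∀ i, NonUnitalCStarAlgebra (D i)]
    (f : ∀ i, 𝔄 →⋆ₙₐ[ℂ] D i) (hbdd : ∀ x, ∃ C, ∀ i, ‖f i x‖ ≤ C) (x : 𝔄) :
    (ofHoms f hbdd).toSeminorm x = ⨆ i, ‖f i x‖ := rfl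

theorem le_ofHoms {ι : Type v} [Nonempty ι] {D : ι → Type w} [∀ i, NonUnitalCStarAlgebra (D i)]
    (f : ∀ i, 𝔄 →⋆ₙₐ[ℂ] D i) (hbdd : ∀ x, ∃ C, ∀ i, ‖f i x‖ ≤ C) (i : ι) (x : 𝔄) :
    ‖f i x‖ ≤ (ofHoms f hbdd).toSeminorm x := by
  obtain ⟨C, hC⟩ := hbdd x
  exact le_ciSup (f := fun i => ‖f i x‖) ⟨C, by rintro _ ⟨i, rfl⟩; exact hC i⟩ i

variable (p : CStarSeminorm 𝔄)

/-- The `*`-algebra `𝔄`, regarded as a seminormed space through the C*-seminorm `p`. -/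
def Pre (_p : CStarSeminorm 𝔄) : Type u := 𝔄

instance : NonUnitalRing p.Pre := inferInstanceAs (NonUnitalRing 𝔄)
instance : StarRing p.Pre := inferInstanceAs (StarRing 𝔄)
instance : Module ℂ p.Pre := inferInstanceAs (Module ℂ 𝔄)
instance [StarModule ℂ 𝔄] : StarModule ℂ p.Pre := inferInstanceAs (StarModule ℂ 𝔄)
instance [IsScalarTower ℂ 𝔄 𝔄] : IsScalarTower ℂ p.Pre p.Pre :=
  inferInstanceAs (IsScalarTower ℂ 𝔄 𝔄)
instance [SMulCommClass ℂ 𝔄 𝔄] : SMulCommClass ℂ p.Pre p.Pre :=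
  inferInstanceAs (SMulCommClass ℂ 𝔄 𝔄)

instance : SeminormedAddCommGroup p.Pre :=
  AddGroupSeminorm.toSeminormedAddCommGroup p.toSeminorm.toAddGroupSeminorm

instance : NonUnitalSeminormedRing p.Pre :=
  { (inferInstance : SeminormedAddCommGroup p.Pre), (inferInstance : NonUnitalRing p.Pre) with
    norm_mul_le := p.mul_le' }

instance : NormedSpace ℂ p.Pre where
  norm_smul_le c x := (p.smul' c x).le

/-- The Hausdorff completion of `𝔄` for the C*-seminorm `p`. -/
def Compl : Type u := UniformSpace.Completion p.Pre

theorem norm_star_pre (x : p.Pre) : ‖star x‖ = ‖x‖ := by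
  have key : ∀ y : p.Pre, ‖y‖ ≤ ‖star y‖ := fun y => by
    by_contra h
    push Not at h
    have h1 : ‖y‖ * ‖y‖ ≤ ‖star y‖ * ‖y‖ := (p.sq_le' y).trans (p.mul_le' _ _)
    have h2 : 0 < ‖y‖ := (norm_nonneg _).trans_lt h
    nlinarith
  exact le_antisymm (by simpa using key (star x)) (key x)

instance : NormedAddCommGroup p.Compl :=
  inferInstanceAs (NormedAddCommGroup (UniformSpace.Completion p.Pre))
instance : NormedSpace ℂ p.Compl :=
  inferInstanceAs (NormedSpace ℂ (UniformSpace.Completion p.Pre))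
instance : CompleteSpace p.Compl :=
  inferInstanceAs (CompleteSpace (UniformSpace.Completion p.Pre))

/-- The canonical map of `𝔄` into its completion, as a linear isometry on `p.Pre`. -/
def coeLI : p.Pre →ₗᵢ[ℂ] p.Compl := UniformSpace.Completion.toComplₗᵢ

theorem denseRange_coeLI : DenseRange p.coeLI := UniformSpace.Completion.denseRange_coe

theorem isDenseInducing_coeLI : IsDenseInducing p.coeLI :=
  UniformSpace.Completion.isDenseInducing_coe

variable {p} in
theorem induction_on {q : p.Compl → Prop} (x : p.Compl) (h : IsClosed {x | q x})
    (ih : ∀ a, q (p.coeLI a)) : q x :=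
  UniformSpace.Completion.induction_on x h ih

variable {p} in
theorem induction_on₂ {q : p.Compl → p.Compl → Prop} (x y : p.Compl)
    (h : IsClosed {x : p.Compl × p.Compl | q x.1 x.2})
    (ih : ∀ a b, q (p.coeLI a) (p.coeLI b)) : q x y :=
  UniformSpace.Completion.induction_on₂ x y h ih

variable {p} in
theorem induction_on₃ {q : p.Compl → p.Compl → p.Compl → Prop} (x y z : p.Compl)
    (h : IsClosed {x : p.Compl × p.Compl × p.Compl | q x.1 x.2.1 x.2.2})
    (ih : ∀ a b c, q (p.coeLI a) (p.coeLI b) (p.coeLI c)) : q x y z :=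
  UniformSpace.Completion.induction_on₃ x y z h ih

instance : Mul p.Compl :=
  ⟨Function.curry <| (p.isDenseInducing_coeLI.prodMap p.isDenseInducing_coeLI).extend
    (p.coeLI ∘ Function.uncurry (· * ·))⟩

theorem coe_mul (a b : p.Pre) : p.coeLI (a * b) = p.coeLI a * p.coeLI b :=
  ((p.isDenseInducing_coeLI.prodMap p.isDenseInducing_coeLI).extend_eq
      (p.coeLI.continuous.comp (@continuous_mul p.Pre _ _ _)) (a, b)).symm

instance : ContinuousMul p.Compl where
  continuous_mul := by
    let m := (AddMonoidHom.mul : p.Pre →+ p.Pre →+ p.Pre).compr₂ p.coeLI.toLinearMap.toAddMonoidHom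
    have : Continuous fun q : p.Pre × p.Pre => m q.1 q.2 :=
      p.coeLI.continuous.comp continuous_mul
    have di : IsDenseInducing (p.coeLI.toLinearMap.toAddMonoidHom : p.Pre → p.Compl) :=
      p.isDenseInducing_coeLI
    exact (di.extend_Z_bilin di this :)

instance : Star p.Compl := ⟨UniformSpace.Completion.map (star : p.Pre → p.Pre)⟩

theorem uniformContinuous_star_pre : UniformContinuous (star : p.Pre → p.Pre) :=
  (AddMonoidHomClass.isometry_of_norm (starAddEquiv : p.Pre ≃+ p.Pre)
    p.norm_star_pre).uniformContinuous

theorem coe_star (a : p.Pre) : p.coeLI (star a) = star (p.coeLI a) :=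
  (UniformSpace.Completion.map_coe p.uniformContinuous_star_pre a).symm

instance : ContinuousStar p.Compl where
  continuous_star := UniformSpace.Completion.continuous_map

theorem compl_zero_mul (a : p.Compl) : 0 * a = 0 :=
  induction_on (q := fun a => 0 * a = 0) a (isClosed_eq (by fun_prop) (by fun_prop)) fun a => by
    rw [← map_zero p.coeLI, ← coe_mul, zero_mul]

theorem compl_mul_zero (a : p.Compl) : a * 0 = 0 :=
  induction_on (q := fun a => a * 0 = 0) a (isClosed_eq (by fun_prop) (by fun_prop)) fun a => by
    rw [← map_zero p.coeLI, ← coe_mul, mul_zero]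

theorem compl_mul_assoc (a b c : p.Compl) : a * b * c = a * (b * c) :=
  induction_on₃ (q := fun a b c => a * b * c = a * (b * c)) a b c
    (isClosed_eq (by fun_prop) (by fun_prop)) fun a b c => by simp only [← coe_mul, mul_assoc]

theorem compl_mul_add (a b c : p.Compl) : a * (b + c) = a * b + a * c :=
  induction_on₃ (q := fun a b c => a * (b + c) = a * b + a * c) a b c
    (isClosed_eq (by fun_prop) (by fun_prop)) fun a b c => by
      simp only [← coe_mul, ← map_add, mul_add]

theorem compl_add_mul (a b c : p.Compl) : (a + b) * c = a * c + b * c :=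
  induction_on₃ (q := fun a b c => (a + b) * c = a * c + b * c) a b c
    (isClosed_eq (by fun_prop) (by fun_prop)) fun a b c => by
      simp only [← coe_mul, ← map_add, add_mul]

theorem compl_norm_mul_le (a b : p.Compl) : ‖a * b‖ ≤ ‖a‖ * ‖b‖ :=
  induction_on₂ (q := fun a b => ‖a * b‖ ≤ ‖a‖ * ‖b‖) a b
    (isClosed_le (by fun_prop) (by fun_prop)) fun a b => by
      simp only [← coe_mul, LinearIsometry.norm_map]; exact norm_mul_le a b

instance : NonUnitalNormedRing p.Compl where
  __ : NormedAddCommGroup p.Compl := inferInstance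
  zero_mul := p.compl_zero_mul
  mul_zero := p.compl_mul_zero
  mul_assoc := p.compl_mul_assoc
  left_distrib := p.compl_mul_add
  right_distrib := p.compl_add_mul
  norm_mul_le := p.compl_norm_mul_le

theorem compl_star_star (a : p.Compl) : star (star a) = a :=
  induction_on (q := fun a => star (star a) = a) a
    (isClosed_eq (continuous_star.comp continuous_star) continuous_id) fun a => by
      simp only [← coe_star, star_star]

theorem compl_star_mul (a b : p.Compl) : star (a * b) = star b * star a :=
  induction_on₂ (q := fun a b => star (a * b) = star b * star a) a b
    (isClosed_eq (continuous_star.comp continuous_mul)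
      ((continuous_star.comp continuous_snd).mul (continuous_star.comp continuous_fst)))
    fun a b => by simp only [← coe_star, ← coe_mul, star_mul]

theorem compl_star_add (a b : p.Compl) : star (a + b) = star a + star b :=
  induction_on₂ (q := fun a b => star (a + b) = star a + star b) a b
    (isClosed_eq (continuous_star.comp continuous_add)
      ((continuous_star.comp continuous_fst).add (continuous_star.comp continuous_snd)))
    fun a b => by simp only [← coe_star, ← map_add, star_add]

instance : StarRing p.Compl where
  star_involutive := p.compl_star_star
  star_mul := p.compl_star_mul
  star_add := p.compl_star_add

theorem compl_norm_mul_self_le (a : p.Compl) : ‖a‖ * ‖a‖ ≤ ‖star a * a‖ :=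
  induction_on (q := fun a => ‖a‖ * ‖a‖ ≤ ‖star a * a‖) a
    (isClosed_le (continuous_norm.mul continuous_norm)
      (continuous_norm.comp (continuous_star.mul continuous_id))) fun a => by
      simp only [← coe_star, ← coe_mul, LinearIsometry.norm_map]; exact p.sq_le' a

instance : CStarRing p.Compl := ⟨fun {a} => p.compl_norm_mul_self_le a⟩

theorem compl_smul_mul [IsScalarTower ℂ 𝔄 𝔄] (c : ℂ) (a b : p.Compl) : (c • a) * b = c • (a * b) :=
  induction_on₂ (q := fun a b => (c • a) * b = c • (a * b)) a b
    (isClosed_eq ((continuous_fst.const_smul c).mul continuous_snd)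
      ((continuous_fst.mul continuous_snd).const_smul c)) fun a b => by
      simp only [← map_smul, ← coe_mul, smul_mul_assoc]

theorem compl_mul_smul [SMulCommClass ℂ 𝔄 𝔄] (c : ℂ) (a b : p.Compl) : a * (c • b) = c • (a * b) :=
  induction_on₂ (q := fun a b => a * (c • b) = c • (a * b)) a b
    (isClosed_eq (continuous_fst.mul (continuous_snd.const_smul c))
      ((continuous_fst.mul continuous_snd).const_smul c)) fun a b => by
      simp only [← map_smul, ← coe_mul, mul_smul_comm]

theorem compl_star_smul [StarModule ℂ 𝔄] (c : ℂ) (a : p.Compl) : star (c • a) = star c • star a :=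
  induction_on (q := fun a => star (c • a) = star c • star a) a
    (isClosed_eq (continuous_star.comp (continuous_const_smul c))
      (continuous_star.const_smul (star c))) fun a => by
      simp only [← coe_star, ← map_smul, star_smul]

instance [StarModule ℂ 𝔄] [IsScalarTower ℂ 𝔄 𝔄] [SMulCommClass ℂ 𝔄 𝔄] :
    NonUnitalCStarAlgebra p.Compl where
  smul_assoc := p.compl_smul_mul
  smul_comm c a b := (p.compl_mul_smul c a b).symm
  star_smul := p.compl_star_smul

/-- The canonical `*`-homomorphism of `𝔄` into its completion. -/
def toCompl : 𝔄 →⋆ₙₐ[ℂ] p.Compl where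
  toFun := p.coeLI
  map_smul' := p.coeLI.map_smul
  map_zero' := p.coeLI.map_zero
  map_add' := p.coeLI.map_add
  map_mul' := p.coe_mul
  map_star' := p.coe_star

theorem norm_toCompl (x : 𝔄) : ‖p.toCompl x‖ = p.toSeminorm x := p.coeLI.norm_map x

theorem denseRange_toCompl : DenseRange p.toCompl := p.denseRange_coeLI

section lift

variable {p} {D : Type v} [NonUnitalCStarAlgebra D]

/-- The continuous extension to the completion of a map on `𝔄`. -/
def extend (f : 𝔄 → D) : p.Compl → D := UniformSpace.Completion.extension (α := p.Pre) f

theorem continuous_extend (f : 𝔄 → D) : Continuous (extend (p := p) f) :=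
  UniformSpace.Completion.continuous_extension

theorem extend_coe (f : 𝔄 →⋆ₙₐ[ℂ] D) (hf : ∀ x, ‖f x‖ ≤ p.toSeminorm x) (a : p.Pre) : extend (p := p) f (p.coeLI a) = f a :=
  UniformSpace.Completion.extension_coe
    (AddMonoidHomClass.lipschitz_of_bound (⟨⟨f, map_zero f⟩, map_add f⟩ : p.Pre →+ D) 1 fun x => by
      rw [one_mul]; exact hf x).uniformContinuous a

/-- A `*`-homomorphism into a C*-algebra that is bounded by the C*-seminorm extends to the
completion. -/
def lift (f : 𝔄 →⋆ₙₐ[ℂ] D) (hf : ∀ x, ‖f x‖ ≤ p.toSeminorm x) : p.Compl →⋆ₙₐ[ℂ] D where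
  toFun := extend (p := p) f
  map_smul' c a := induction_on
    (q := fun a => extend (p := p) f (c • a) = c • extend (p := p) f a) a
    (isClosed_eq ((continuous_extend f).comp (continuous_const_smul c))
      ((continuous_extend f).const_smul c)) fun a => by
      rw [← map_smul, extend_coe f hf, extend_coe f hf]; exact map_smul f c a
  map_zero' := by rw [← map_zero p.coeLI, extend_coe f hf]; exact map_zero f
  map_add' a b := induction_on₂
    (q := fun a b => extend (p := p) f (a + b) = extend (p := p) f a + extend (p := p) f b) a b
    (isClosed_eq ((continuous_extend f).comp continuous_add)
      (((continuous_extend f).comp continuous_fst).add ((continuous_extend f).comp continuous_snd)))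
    fun a b => by
      rw [← map_add, extend_coe f hf, extend_coe f hf, extend_coe f hf]; exact map_add f a b
  map_mul' a b := induction_on₂
    (q := fun a b => extend (p := p) f (a * b) = extend (p := p) f a * extend (p := p) f b) a b
    (isClosed_eq ((continuous_extend f).comp continuous_mul)
      (((continuous_extend f).comp continuous_fst).mul ((continuous_extend f).comp continuous_snd)))
    fun a b => by
      rw [← coe_mul, extend_coe f hf, extend_coe f hf, extend_coe f hf]; exact map_mul f a b
  map_star' a := induction_on
    (q := fun a => extend (p := p) f (star a) = star (extend (p := p) f a)) a
    (isClosed_eq ((continuous_extend f).comp continuous_star)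
      (continuous_star.comp (continuous_extend f))) fun a => by
      rw [← coe_star, extend_coe f hf, extend_coe f hf]; exact map_star f a

theorem lift_toCompl (f : 𝔄 →⋆ₙₐ[ℂ] D) (hf : ∀ x, ‖f x‖ ≤ p.toSeminorm x) (x : 𝔄) : lift f hf (p.toCompl x) = f x := extend_coe f hf x

end lift

end CStarSeminorm

/-- A C*-algebra that has a two-sided unit `e`, as a unital C*-algebra. -/
abbrev CStarAlgebra.ofUnit {E : Type u} [inst : NonUnitalCStarAlgebra E] (e : E)
    (h₁ : ∀ x, e * x = x) (h₂ : ∀ x, x * e = x) : CStarAlgebra E :=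
  letI r : NormedRing E := { inst with one := e, one_mul := h₁, mul_one := h₂ }
  letI : NormedAlgebra ℂ E :=
    { Algebra.ofModule (R := ℂ) (A := E) smul_mul_assoc mul_smul_comm with
      norm_smul_le := norm_smul_le }
  { inst, r, (inferInstance : NormedAlgebra ℂ E) with }


theorem continuous_starHom {A : Type u} {B : Type v} [NonUnitalCStarAlgebra A]
    [NonUnitalCStarAlgebra B] (f : A →⋆ₙₐ[ℂ] B) : Continuous f :=
  AddMonoidHomClass.continuous_of_bound f 1 fun x => by
    rw [one_mul]; exact NonUnitalStarAlgHom.norm_apply_le f x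

/-! ### The minimal tensor product -/

/-- The Hilbert space tensor product: the completion of the algebraic tensor product for the inner
product `⟪h ⊗ k, h' ⊗ k'⟫ = ⟪h, h'⟫ ⟪k, k'⟫`. -/
def HTensor (H K : Type u) [NormedAddCommGroup H] [InnerProductSpace ℂ H]
    [NormedAddCommGroup K] [InnerProductSpace ℂ K] : Type u :=
  UniformSpace.Completion (H ⊗[ℂ] K)

namespace HTensor

variable {H K H' K' : Type u} [NormedAddCommGroup H] [InnerProductSpace ℂ H]
  [NormedAddCommGroup K] [InnerProductSpace ℂ K] [NormedAddCommGroup H'] [InnerProductSpace ℂ H']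
  [NormedAddCommGroup K'] [InnerProductSpace ℂ K']

instance : NormedAddCommGroup (HTensor H K) :=
  inferInstanceAs (NormedAddCommGroup (UniformSpace.Completion (H ⊗[ℂ] K)))
instance : InnerProductSpace ℂ (HTensor H K) :=
  inferInstanceAs (InnerProductSpace ℂ (UniformSpace.Completion (H ⊗[ℂ] K)))
instance : CompleteSpace (HTensor H K) :=
  inferInstanceAs (CompleteSpace (UniformSpace.Completion (H ⊗[ℂ] K)))

/-- The inclusion of the algebraic tensor product. -/
def of : H ⊗[ℂ] K →ₗᵢ[ℂ] HTensor H K := UniformSpace.Completion.toComplₗᵢ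

theorem denseRange_of : DenseRange (of : H ⊗[ℂ] K →ₗᵢ[ℂ] HTensor H K) :=
  UniformSpace.Completion.denseRange_coe

/-- The elementary tensor `h ⊗ k`. -/
def tmul (h : H) (k : K) : HTensor H K := of (h ⊗ₜ k)

theorem add_tmul (h h' : H) (k : K) : tmul (h + h') k = tmul h k + tmul h' k := by
  simp only [tmul, TensorProduct.add_tmul, map_add]
theorem tmul_add (h : H) (k k' : K) : tmul h (k + k') = tmul h k + tmul h k' := by
  simp only [tmul, TensorProduct.tmul_add, map_add]
theorem smul_tmul (c : ℂ) (h : H) (k : K) : tmul (c • h) k = c • tmul h k := by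
  simp only [tmul, ← TensorProduct.smul_tmul', map_smul]
theorem tmul_smul (c : ℂ) (h : H) (k : K) : tmul h (c • k) = c • tmul h k := by
  simp only [tmul, TensorProduct.tmul_smul, map_smul]

theorem inner_tmul (h h' : H) (k k' : K) :
    inner ℂ (tmul h k) (tmul h' k') = inner ℂ h h' * inner ℂ k k' :=
  (UniformSpace.Completion.inner_coe _ _).trans (TensorProduct.inner_tmul _ _ _ _ _)

theorem ext {E : Type v} [NormedAddCommGroup E] [NormedSpace ℂ E] {S T : HTensor H K →L[ℂ] E}
    (h : ∀ x y, S (tmul x y) = T (tmul x y)) : S = T := by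
  refine DFunLike.coe_injective
    (denseRange_of.equalizer S.continuous T.continuous (funext fun t => ?_))
  induction t with
  | zero => simp
  | tmul a b => exact h a b
  | add x y hx hy =>
    simp only [Function.comp_apply, map_add] at hx hy ⊢
    rw [hx, hy]

/-- The bounded operator `S ⊗ T`. -/
def map (S : H →L[ℂ] H') (T : K →L[ℂ] K') : HTensor H K →L[ℂ] HTensor H' K' :=
  (TensorProduct.mapL S T).completion

theorem map_of (S : H →L[ℂ] H') (T : K →L[ℂ] K') (z : H ⊗[ℂ] K) :
    map S T (of z) = of (TensorProduct.mapL S T z) :=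
  ContinuousLinearMap.completion_apply_coe _ _

theorem map_tmul (S : H →L[ℂ] H') (T : K →L[ℂ] K') (h : H) (k : K) :
    map S T (tmul h k) = tmul (S h) (T k) := map_of S T _

theorem norm_map_le (S : H →L[ℂ] H') (T : K →L[ℂ] K') : ‖map S T‖ ≤ ‖S‖ * ‖T‖ := by
  refine ContinuousLinearMap.opNorm_le_bound _ (by positivity) fun z => ?_
  refine denseRange_of.induction_on z (isClosed_le (by fun_prop) (by fun_prop)) fun z => ?_
  rw [map_of, LinearIsometry.norm_map, LinearIsometry.norm_map]
  exact (ContinuousLinearMap.le_opNorm _ z).trans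
    (mul_le_mul_of_nonneg_right (TensorProduct.norm_mapL_le S T) (norm_nonneg _))

theorem adjoint_map [CompleteSpace H] [CompleteSpace K] [CompleteSpace H'] [CompleteSpace K']
    (S : H →L[ℂ] H') (T : K →L[ℂ] K') :
    map S.adjoint T.adjoint = (map S T).adjoint := by
  refine ext fun h k => ext_inner_right ℂ fun w => ?_
  rw [ContinuousLinearMap.adjoint_inner_left]
  refine congrFun (congrArg DFunLike.coe (ext (S := innerSL ℂ (map S.adjoint T.adjoint (tmul h k)))
    (T := (innerSL ℂ (tmul h k)).comp (map S T)) fun x y => ?_)) w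
  simp only [innerSL_apply_apply, ContinuousLinearMap.comp_apply, map_tmul, inner_tmul,
    ContinuousLinearMap.adjoint_inner_left]

end HTensor

/-- A representation of a C*-algebra on a Hilbert space. -/
structure HilbertRep (A : Type u) [NonUnitalCStarAlgebra A] where
  H : Type u
  [normed : NormedAddCommGroup H]
  [innerProduct : InnerProductSpace ℂ H]
  [complete : CompleteSpace H]
  π : A →⋆ₙₐ[ℂ] (H →L[ℂ] H)

attribute [instance] HilbertRep.normed HilbertRep.innerProduct HilbertRep.complete

instance (A : Type u) [NonUnitalCStarAlgebra A] : Nonempty (HilbertRep A) :=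
  ⟨{ H := EuclideanSpace ℂ PEmpty.{u + 1}, π := 0 }⟩

namespace HilbertRep

variable {A B : Type u} [NonUnitalCStarAlgebra A] [NonUnitalCStarAlgebra B]

/-- The pull-back of a representation along a `*`-homomorphism. -/
abbrev comp (ρ : HilbertRep B) (f : A →⋆ₙₐ[ℂ] B) : HilbertRep A := { H := ρ.H, π := ρ.π.comp f }

/-- The algebraic tensor product `π₁ ⊗ π₂` of two representations, on the Hilbert space tensor
product of the two Hilbert spaces. -/
def tensor (ρ : HilbertRep A) (σ : HilbertRep B) :
    A ⊗[ℂ] B →⋆ₙₐ[ℂ] (HTensor ρ.H σ.H →L[ℂ] HTensor ρ.H σ.H) :=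
  let F : A ⊗[ℂ] B →ₗ[ℂ] (HTensor ρ.H σ.H →L[ℂ] HTensor ρ.H σ.H) :=
    TensorProduct.lift (LinearMap.mk₂ ℂ (fun a b => HTensor.map (ρ.π a) (σ.π b))
      (fun a a' b => HTensor.ext fun h k => by simp [HTensor.map_tmul, HTensor.add_tmul])
      (fun c a b => HTensor.ext fun h k => by simp [HTensor.map_tmul, HTensor.smul_tmul])
      (fun a b b' => HTensor.ext fun h k => by simp [HTensor.map_tmul, HTensor.tmul_add])
      (fun c a b => HTensor.ext fun h k => by simp [HTensor.map_tmul, HTensor.tmul_smul]))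
  have hF : ∀ a b, F (a ⊗ₜ b) = HTensor.map (ρ.π a) (σ.π b) := fun a b => rfl
  { toFun := F
    map_smul' := fun c t => map_smul F c t
    map_zero' := map_zero F
    map_add' := map_add F
    map_mul' := fun s t => by
      induction s with
      | zero => simp
      | add x₁ x₂ h₁ h₂ => simp only [add_mul, map_add, h₁, h₂]
      | tmul a b =>
        induction t with
        | zero => simp
        | add y₁ y₂ h₁ h₂ => simp only [mul_add, map_add, h₁, h₂]
        | tmul a' b' =>
          rw [Algebra.TensorProduct.tmul_mul_tmul, hF, hF, hF]
          exact HTensor.ext fun h k => by simp [HTensor.map_tmul]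
    map_star' := fun t => by
      induction t with
      | zero => simp
      | add x₁ x₂ h₁ h₂ => simp only [star_add, map_add, h₁, h₂]
      | tmul a b =>
        rw [TensorProduct.star_tmul, hF, hF, map_star, map_star,
          ContinuousLinearMap.star_eq_adjoint, ContinuousLinearMap.star_eq_adjoint,
          ContinuousLinearMap.star_eq_adjoint, HTensor.adjoint_map] }

theorem tensor_tmul (ρ : HilbertRep A) (σ : HilbertRep B) (a : A) (b : B) :
    ρ.tensor σ (a ⊗ₜ b) = HTensor.map (ρ.π a) (σ.π b) := rfl

theorem norm_tensor_bdd (t : A ⊗[ℂ] B) :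
    ∃ C, ∀ r : HilbertRep A × HilbertRep B, ‖r.1.tensor r.2 t‖ ≤ C := by
  induction t with
  | zero => exact ⟨0, fun r => by simp⟩
  | add x y hx hy =>
    obtain ⟨C, hC⟩ := hx
    obtain ⟨D, hD⟩ := hy
    exact ⟨C + D, fun r => by
      rw [map_add]; exact (norm_add_le _ _).trans (add_le_add (hC r) (hD r))⟩
  | tmul a b =>
    exact ⟨‖a‖ * ‖b‖, fun r => (HTensor.norm_map_le _ _).trans
      (mul_le_mul (NonUnitalStarAlgHom.norm_apply_le _ _) (NonUnitalStarAlgHom.norm_apply_le _ _)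
        (norm_nonneg _) (norm_nonneg _))⟩

end HilbertRep

section MinTensor

variable (A B : Type u) [NonUnitalCStarAlgebra A] [NonUnitalCStarAlgebra B]

/-- The minimal (spatial) C*-seminorm on the algebraic tensor product: the supremum of the operator
norms `‖(π₁ ⊗ π₂)(t)‖` over all pairs of Hilbert space representations. -/
def minSeminorm : CStarSeminorm (A ⊗[ℂ] B) :=
  CStarSeminorm.ofHoms (fun r : HilbertRep A × HilbertRep B => r.1.tensor r.2)
    HilbertRep.norm_tensor_bdd

theorem minSeminorm_apply (t : A ⊗[ℂ] B) : (minSeminorm A B).toSeminorm t =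
    ⨆ r : HilbertRep A × HilbertRep B, ‖r.1.tensor r.2 t‖ := rfl

/-- The minimal tensor product of two C*-algebras. -/
def MinTensor : Type u := (minSeminorm A B).Compl

infixl:70 " ⊗min " => MinTensor

/-- The C*-algebra structure of the minimal tensor product. -/
def MinTensor.nonUnitalCStarAlgebra : NonUnitalCStarAlgebra (A ⊗min B) :=
  inferInstanceAs (NonUnitalCStarAlgebra (minSeminorm A B).Compl)

instance : NonUnitalCStarAlgebra (A ⊗min B) := MinTensor.nonUnitalCStarAlgebra A B

/-- The canonical `*`-homomorphism from the algebraic to the minimal tensor product. -/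
def MinTensor.of : A ⊗[ℂ] B →⋆ₙₐ[ℂ] A ⊗min B := (minSeminorm A B).toCompl

theorem MinTensor.norm_of (t : A ⊗[ℂ] B) :
    ‖MinTensor.of A B t‖ = ⨆ r : HilbertRep A × HilbertRep B, ‖r.1.tensor r.2 t‖ :=
  (minSeminorm A B).norm_toCompl t

theorem MinTensor.denseRange_of : DenseRange (MinTensor.of A B) :=
  (minSeminorm A B).denseRange_toCompl

variable {A B}

/-- The elementary tensor `a ⊗ b` in the minimal tensor product. -/
def MinTensor.tmul (a : A) (b : B) : A ⊗min B := MinTensor.of A B (a ⊗ₜ b)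

infixl:100 " ⊗ₑ " => MinTensor.tmul

theorem MinTensor.tmul_mul_tmul (a a' : A) (b b' : B) :
    (a ⊗ₑ b) * (a' ⊗ₑ b') = (a * a') ⊗ₑ (b * b') := by
  simp only [MinTensor.tmul, ← map_mul, Algebra.TensorProduct.tmul_mul_tmul]

theorem MinTensor.star_tmul (a : A) (b : B) : star (a ⊗ₑ b) = star a ⊗ₑ star b := by
  simp only [MinTensor.tmul, ← map_star, TensorProduct.star_tmul]

/-- Two continuous additive maps that agree on elementary tensors are equal. -/
theorem MinTensor.ext_of_continuous {D : Type v} [AddCommMonoid D] [TopologicalSpace D] [T2Space D]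
    {f g : A ⊗min B →+ D} (hf : Continuous f) (hg : Continuous g)
    (h : ∀ a b, f (a ⊗ₑ b) = g (a ⊗ₑ b)) (x : A ⊗min B) : f x = g x := by
  refine congrFun ((MinTensor.denseRange_of A B).equalizer hf hg (funext fun t => ?_)) x
  induction t with
  | zero => simp
  | tmul a b => exact h a b
  | add x y hx hy =>
    simp only [Function.comp_apply, map_add] at hx hy ⊢
    rw [hx, hy]

variable {A' B' : Type u} [NonUnitalCStarAlgebra A'] [NonUnitalCStarAlgebra B']

/-- The algebraic tensor product of two `*`-homomorphisms, with values in the minimal tensor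
product. -/
def MinTensor.mapAlg (f : A →⋆ₙₐ[ℂ] A') (g : B →⋆ₙₐ[ℂ] B') : A ⊗[ℂ] B →⋆ₙₐ[ℂ] A' ⊗min B' where
  toFun t := MinTensor.of A' B' (TensorProduct.map (f : A →ₗ[ℂ] A') (g : B →ₗ[ℂ] B') t)
  map_smul' c t := by simp
  map_zero' := by simp
  map_add' s t := by simp
  map_mul' s t := by
    rw [← map_mul]
    congr 1
    induction s with
    | zero => simp
    | add x₁ x₂ h₁ h₂ => simp only [add_mul, map_add, h₁, h₂]
    | tmul a b =>
      induction t with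
      | zero => simp
      | add y₁ y₂ h₁ h₂ => simp only [mul_add, map_add, h₁, h₂]
      | tmul a' b' => simp
  map_star' t := by
    rw [← map_star]
    congr 1
    induction t with
    | zero => simp
    | add x₁ x₂ h₁ h₂ => simp only [star_add, map_add, h₁, h₂]
    | tmul a b => simp [map_star]

theorem MinTensor.norm_mapAlg_le (f : A →⋆ₙₐ[ℂ] A') (g : B →⋆ₙₐ[ℂ] B') (t : A ⊗[ℂ] B) :
    ‖MinTensor.mapAlg f g t‖ ≤ (minSeminorm A B).toSeminorm t := by
  change ‖MinTensor.of A' B' _‖ ≤ _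
  rw [MinTensor.norm_of, minSeminorm_apply]
  refine ciSup_le fun r => ?_
  have h : r.1.tensor r.2 (TensorProduct.map (f : A →ₗ[ℂ] A') (g : B →ₗ[ℂ] B') t)
      = (r.1.comp f).tensor (r.2.comp g) t := by
    induction t with
    | zero => simp only [map_zero]
    | add x₁ x₂ h₁ h₂ => simp only [map_add, h₁, h₂]
    | tmul a b => rfl
  rw [h]
  exact CStarSeminorm.le_ofHoms (fun r : HilbertRep A × HilbertRep B => r.1.tensor r.2)
    HilbertRep.norm_tensor_bdd (r.1.comp f, r.2.comp g) t

/-- The tensor product `f ⊗ g` of two `*`-homomorphisms, on minimal tensor products. -/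
def MinTensor.map (f : A →⋆ₙₐ[ℂ] A') (g : B →⋆ₙₐ[ℂ] B') : A ⊗min B →⋆ₙₐ[ℂ] A' ⊗min B' :=
  CStarSeminorm.lift (MinTensor.mapAlg f g) (MinTensor.norm_mapAlg_le f g)

theorem MinTensor.map_tmul (f : A →⋆ₙₐ[ℂ] A') (g : B →⋆ₙₐ[ℂ] B') (a : A) (b : B) :
    MinTensor.map f g (a ⊗ₑ b) = f a ⊗ₑ g b :=
  CStarSeminorm.lift_toCompl _ (MinTensor.norm_mapAlg_le f g) _

end MinTensor

attribute [irreducible] MinTensor.nonUnitalCStarAlgebra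

section unit

variable {A B : Type u} [CStarAlgebra A] [CStarAlgebra B]

theorem MinTensor.one_tmul_one_mul (x : A ⊗min B) : ((1 : A) ⊗ₑ (1 : B)) * x = x :=
  MinTensor.ext_of_continuous (f := AddMonoidHom.mulLeft ((1 : A) ⊗ₑ (1 : B)))
    (g := AddMonoidHom.id _) (continuous_const_mul _) continuous_id
    (fun a b => by simp [MinTensor.tmul_mul_tmul]) x

theorem MinTensor.mul_one_tmul_one (x : A ⊗min B) : x * ((1 : A) ⊗ₑ (1 : B)) = x :=
  MinTensor.ext_of_continuous (f := AddMonoidHom.mulRight ((1 : A) ⊗ₑ (1 : B)))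
    (g := AddMonoidHom.id _) (continuous_mul_const _) continuous_id
    (fun a b => by simp [MinTensor.tmul_mul_tmul]) x

/-- The minimal tensor product of unital C*-algebras is unital, with unit `1 ⊗ 1`. -/
abbrev MinTensor.cstarAlgebra : CStarAlgebra (A ⊗min B) :=
  CStarAlgebra.ofUnit ((1 : A) ⊗ₑ (1 : B)) MinTensor.one_tmul_one_mul MinTensor.mul_one_tmul_one

end unit

/-! ### The c₀-direct sum of C*-algebras -/

section C0Sum

variable {ι : Type u} (A : ι → Type v) [∀ i, NonUnitalCStarAlgebra (A i)]

/-- The families `(a_i)` such that `‖a_i‖ → 0` along the cofinite filter, i.e. such that for every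
`ε > 0` there are only finitely many `i` with `‖a_i‖ ≥ ε`. -/
def c0Subalgebra : NonUnitalStarSubalgebra ℂ (lp A ∞) where
  carrier := {x | Tendsto (fun i => ‖x i‖) cofinite (𝓝 0)}
  zero_mem' := by simpa using tendsto_const_nhds
  add_mem' {x y} hx hy := by
    refine squeeze_zero (fun i => norm_nonneg _) (fun i => norm_add_le (x i) (y i)) ?_
    simpa using hx.add hy
  mul_mem' {x y} hx hy := by
    refine squeeze_zero (fun i => norm_nonneg _) (fun i => norm_mul_le (x i) (y i)) ?_
    simpa using hx.mul hy
  smul_mem' c x hx := by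
    refine squeeze_zero (fun i => norm_nonneg _) (fun i => norm_smul_le c (x i)) ?_
    simpa using hx.const_mul ‖c‖
  star_mem' {x} hx := by
    refine hx.congr fun i => ?_
    rw [lp.star_apply, norm_star]

instance c0Subalgebra.isClosed : IsClosed (c0Subalgebra A : Set (lp A ∞)) := by
  refine isClosed_of_closure_subset fun x hx => ?_
  change Tendsto (fun i => ‖x i‖) cofinite (𝓝 0)
  rw [Metric.tendsto_nhds]
  intro ε hε
  obtain ⟨y, hy, hxy⟩ := Metric.mem_closure_iff.1 hx (ε / 2) (half_pos hε)
  have hy' : Tendsto (fun i => ‖y i‖) cofinite (𝓝 0) := hy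
  filter_upwards [(Metric.tendsto_nhds.1 hy') (ε / 2) (half_pos hε)] with i hi
  rw [dist_zero_right, norm_norm] at hi ⊢
  rw [dist_eq_norm] at hxy
  have h1 : ‖x i - y i‖ ≤ ‖x - y‖ := lp.norm_apply_le_norm ENNReal.top_ne_zero (x - y) i
  calc ‖x i‖ = ‖(x i - y i) + y i‖ := by rw [sub_add_cancel]
    _ ≤ ‖x i - y i‖ + ‖y i‖ := norm_add_le _ _
    _ < ε := by linarith

/-- The direct sum of a family of C*-algebras. -/
def C0Sum : Type (max u v) := c0Subalgebra A

instance : NonUnitalCStarAlgebra (C0Sum A) :=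
  inferInstanceAs (NonUnitalCStarAlgebra (c0Subalgebra A))

namespace C0Sum

/-- The `i`-th component. -/
def proj (i : ι) : C0Sum A →⋆ₙₐ[ℂ] A i where
  toFun x := x.1 i
  map_smul' _ _ := rfl
  map_zero' := rfl
  map_add' _ _ := rfl
  map_mul' _ _ := rfl
  map_star' _ := rfl

variable {A}

theorem tendsto_proj (x : C0Sum A) : Tendsto (fun i => ‖proj A i x‖) cofinite (𝓝 0) := x.2

theorem ext {x y : C0Sum A} (h : ∀ i, proj A i x = proj A i y) : x = y :=
  Subtype.ext (lp.ext (funext h))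

theorem norm_proj_le (i : ι) (x : C0Sum A) : ‖proj A i x‖ ≤ ‖x‖ :=
  lp.norm_apply_le_norm ENNReal.top_ne_zero x.1 i

theorem norm_le {x : C0Sum A} {C : ℝ} (hC : 0 ≤ C) (h : ∀ i, ‖proj A i x‖ ≤ C) : ‖x‖ ≤ C :=
  lp.norm_le_of_forall_le hC h

open Classical in
theorem single_mem (i : ι) (a : A i) : lp.single ∞ i a ∈ c0Subalgebra A := by
  change Tendsto (fun j => ‖lp.single ∞ i a j‖) cofinite (𝓝 0)
  refine tendsto_const_nhds.congr' ?_
  have : ∀ᶠ j in cofinite, j ≠ i := by simp [eventually_cofinite]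
  filter_upwards [this] with j hj
  rw [lp.single_apply_ne _ _ _ hj, norm_zero]

variable (A) in
open Classical in
/-- The inclusion of the `i`-th summand. -/
def of (i : ι) : A i →⋆ₙₐ[ℂ] C0Sum A where
  toFun a := ⟨lp.single ∞ i a, single_mem i a⟩
  map_smul' c a := Subtype.ext (lp.single_smul _ _ _ _)
  map_zero' := Subtype.ext (lp.single_zero _ _)
  map_add' a b := Subtype.ext (lp.single_add _ _ _ _)
  map_mul' a b := Subtype.ext (lp.ext (by
    change Pi.single i (a * b) = Pi.single i a * Pi.single i b
    exact Pi.single_mul _ _ _))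
  map_star' a := Subtype.ext (lp.ext (by
    change Pi.single i (star a) = star (Pi.single i a)
    exact Pi.single_star i a))

theorem proj_of_self (i : ι) (a : A i) : proj A i (of A i a) = a := by
  classical exact lp.single_apply_self (E := A) ∞ i a

theorem proj_of_ne {i j : ι} (h : j ≠ i) (a : A i) : proj A j (of A i a) = 0 := by
  classical exact lp.single_apply_ne (E := A) ∞ i a h

theorem of_mul_of_ne {i j : ι} (h : i ≠ j) (a : A i) (b : A j) : of A i a * of A j b = 0 :=
  ext fun k => by
    rw [map_mul, map_zero]
    by_cases hk : k = i
    · subst hk; rw [proj_of_ne h, mul_zero]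
    · rw [proj_of_ne hk, zero_mul]

theorem hasSum_of (x : C0Sum A) : HasSum (fun i => of A i (proj A i x)) x := by
  classical
  rw [HasSum, SummationFilter.unconditional_filter, Metric.tendsto_atTop]
  intro ε hε
  have h := (Metric.tendsto_nhds.1 (tendsto_proj x)) (ε / 2) (half_pos hε)
  rw [eventually_cofinite] at h
  refine ⟨h.toFinset, fun s hs => ?_⟩
  rw [dist_eq_norm]
  refine (norm_le (half_pos hε).le fun i => ?_).trans_lt (half_lt_self hε)
  rw [map_sub, map_sum]
  by_cases hi : i ∈ s
  · rw [Finset.sum_eq_single i (fun j _ hj => proj_of_ne hj.symm _) (fun h => absurd hi h),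
      proj_of_self, sub_self, norm_zero]
    exact (half_pos hε).le
  · rw [Finset.sum_eq_zero (fun j hj => proj_of_ne (fun e : i = j => hi (by rw [e]; exact hj)) _), zero_sub, norm_neg]
    by_contra hlt
    refine hi (hs ?_)
    rw [Set.Finite.mem_toFinset]
    simp only [dist_zero_right, norm_norm, not_lt, Set.mem_ofPred_eq]
    exact (not_le.1 hlt).le

section lift

variable {D : Type w} [NonUnitalCStarAlgebra D]

theorem summable_lift (f : ∀ i, A i →⋆ₙₐ[ℂ] D) (hf : ∀ i j, i ≠ j → ∀ a b, f i a * f j b = 0)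
    (x : C0Sum A) : Summable fun i => f i (proj A i x) := by
  classical
  have key : ∀ (s : Finset ι) (C : ℝ), 0 ≤ C → (∀ i ∈ s, ‖proj A i x‖ ≤ C) →
      ‖∑ i ∈ s, f i (proj A i x)‖ ≤ C := by
    intro s C hC h
    let : NonUnitalCStarAlgebra (∀ i : s, A i) := { }
    let g : (∀ i : s, A i) →⋆ₙₐ[ℂ] D :=
      { toFun := fun a => ∑ i : s, f i (a i)
        map_smul' := fun c a => by simp [Finset.smul_sum]
        map_zero' := by simp
        map_add' := fun a b => by simp [Finset.sum_add_distrib]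
        map_mul' := fun a b => by
          rw [Finset.sum_mul_sum]
          refine Finset.sum_congr rfl fun i _ => ?_
          rw [Finset.sum_eq_single i
            (fun j _ hj => hf _ _ (fun e => hj (Subtype.ext e.symm)) _ _) (by simp),
            Pi.mul_apply, map_mul]
        map_star' := fun a => by simp [star_sum, map_star] }
    have h1 := NonUnitalStarAlgHom.norm_apply_le g (fun i : s => proj A i x)
    have h2 : g (fun i : s => proj A i x) = ∑ i ∈ s, f i (proj A i x) :=
      Finset.sum_coe_sort s fun i => f i (proj A i x)
    rw [← h2]
    exact h1.trans ((pi_norm_le_iff_of_nonneg hC).2 fun i => h i i.2)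
  rw [summable_iff_vanishing_norm]
  intro ε hε
  have h := (Metric.tendsto_nhds.1 (tendsto_proj x)) (ε / 2) (half_pos hε)
  rw [eventually_cofinite] at h
  refine ⟨h.toFinset, fun t ht => (key t (ε / 2) (half_pos hε).le fun i hi => ?_).trans_lt
    (half_lt_self hε)⟩
  by_contra hlt
  refine Finset.disjoint_left.1 ht hi ?_
  rw [Set.Finite.mem_toFinset]
  simp only [dist_zero_right, norm_norm, not_lt, Set.mem_ofPred_eq]
  exact (not_le.1 hlt).le

/-- The `*`-homomorphism `(a_i) ↦ ∑ f_i (a_i)` on a direct sum that is given by `*`-homomorphisms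
`f_i` with mutually orthogonal ranges. -/
def lift (f : ∀ i, A i →⋆ₙₐ[ℂ] D) (hf : ∀ i j, i ≠ j → ∀ a b, f i a * f j b = 0) :
    C0Sum A →⋆ₙₐ[ℂ] D where
  toFun x := ∑' i, f i (proj A i x)
  map_smul' c x := by
    simp only [map_smul, MonoidHom.id_apply]
    exact (summable_lift f hf x).tsum_const_smul c
  map_zero' := by simp
  map_add' x y := by
    simp only [map_add]
    exact (summable_lift f hf x).tsum_add (summable_lift f hf y)
  map_mul' x y := by
    have h1 := (summable_lift f hf x)
    rw [← h1.tsum_mul_right]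
    refine tsum_congr fun i => ?_
    rw [← (summable_lift f hf y).tsum_mul_left, tsum_eq_single i, map_mul, map_mul]
    intro j hj
    exact hf i j hj.symm _ _
  map_star' x := by
    simp only [map_star]
    exact tsum_star.symm

theorem lift_apply (f : ∀ i, A i →⋆ₙₐ[ℂ] D) (hf : ∀ i j, i ≠ j → ∀ a b, f i a * f j b = 0)
    (x : C0Sum A) : lift f hf x = ∑' i, f i (proj A i x) := rfl

theorem lift_of (f : ∀ i, A i →⋆ₙₐ[ℂ] D) (hf : ∀ i j, i ≠ j → ∀ a b, f i a * f j b = 0)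
    (i : ι) (a : A i) : lift f hf (of A i a) = f i a := by
  rw [lift_apply, tsum_eq_single i, proj_of_self]
  intro j hj
  rw [proj_of_ne hj, map_zero]

end lift

end C0Sum

end C0Sum

/-! ### Nondegenerate `0`-`1` matrices -/

/-- A nondegenerate square matrix with entries `0` or `1`: no row and no column is zero. -/
@[ext]
structure NDMatrix where
  size : ℕ
  size_pos : 0 < size
  mat : Matrix (Fin size) (Fin size) ℕ
  zero_or_one : ∀ i j, mat i j = 0 ∨ mat i j = 1
  row_ne_zero : ∀ i, ∃ j, mat i j ≠ 0
  col_ne_zero : ∀ j, ∃ i, mat i j ≠ 0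

namespace NDMatrix

/-- The matrix `1` of size one. -/
def one : NDMatrix where
  size := 1
  size_pos := one_pos
  mat := fun _ _ => 1
  zero_or_one _ _ := Or.inr rfl
  row_ne_zero i := ⟨i, one_ne_zero⟩
  col_ne_zero i := ⟨i, one_ne_zero⟩

/-- The Kronecker product. With indices that start at `0`, the pair `(i, j)` has index `m * i + j`
if the second factor has size `m`. -/
def kron (B C : NDMatrix) : NDMatrix where
  size := B.size * C.size
  size_pos := Nat.mul_pos B.size_pos C.size_pos
  mat := Matrix.reindex finProdFinEquiv finProdFinEquiv (Matrix.kronecker B.mat C.mat)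
  zero_or_one k l := by
    change B.mat k.divNat l.divNat * C.mat k.modNat l.modNat = 0 ∨
      B.mat k.divNat l.divNat * C.mat k.modNat l.modNat = 1
    rcases B.zero_or_one k.divNat l.divNat with h | h <;>
    rcases C.zero_or_one k.modNat l.modNat with h' | h' <;> simp [h, h']
  row_ne_zero k := by
    obtain ⟨i, hi⟩ := B.row_ne_zero (finProdFinEquiv.symm k).1
    obtain ⟨j, hj⟩ := C.row_ne_zero (finProdFinEquiv.symm k).2
    exact ⟨finProdFinEquiv (i, j), by
      simpa [Matrix.reindex_apply, Matrix.kronecker_apply] using ⟨hi, hj⟩⟩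
  col_ne_zero k := by
    obtain ⟨i, hi⟩ := B.col_ne_zero (finProdFinEquiv.symm k).1
    obtain ⟨j, hj⟩ := C.col_ne_zero (finProdFinEquiv.symm k).2
    exact ⟨finProdFinEquiv (i, j), by
      simpa [Matrix.reindex_apply, Matrix.kronecker_apply] using ⟨hi, hj⟩⟩

infixl:70 " ⊠ " => NDMatrix.kron

theorem kron_mat (B C : NDMatrix) (i i' : Fin B.size) (j j' : Fin C.size) :
    (B ⊠ C).mat (finProdFinEquiv (i, j)) (finProdFinEquiv (i', j')) = B.mat i i' * C.mat j j' := by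
  simp [kron]

/-- The set of all pairs `(B, C)` with `B ⊠ C = A`. -/
abbrev Factorization (A : NDMatrix) : Type := {p : NDMatrix × NDMatrix // p.1 ⊠ p.2 = A}

theorem finite_size_le (n : ℕ) : {M : NDMatrix | M.size ≤ n}.Finite := by
  let F : {M : NDMatrix | M.size ≤ n} → Σ k : Fin (n + 1), (Fin k → Fin k → Bool) :=
    fun M => ⟨⟨M.1.size, Nat.lt_succ_of_le M.2⟩, fun i j => decide (M.1.mat i j = 0)⟩
  have hF : Function.Injective F := by
    rintro ⟨⟨k, hk, M, h, hr, hc⟩, hn⟩ ⟨⟨k', hk', M', h', hr', hc'⟩, hn'⟩ e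
    simp only [F, Sigma.mk.injEq, Fin.mk.injEq] at e
    obtain ⟨rfl, e⟩ := e
    have : M = M' := by
      ext i j
      have h2 := congrFun (congrFun (eq_of_heq e) i) j
      rw [decide_eq_decide] at h2
      rcases h i j with h3 | h3 <;> rcases h' i j with h4 | h4 <;> simp_all
    subst this
    rfl
  exact Finite.of_injective F hF


instance (A : NDMatrix) : Finite A.Factorization := by
  have h := (finite_size_le A.size).prod (finite_size_le A.size)
  have : Finite ({M : NDMatrix | M.size ≤ A.size} ×ˢ {M : NDMatrix | M.size ≤ A.size} :
    Set (NDMatrix × NDMatrix)) := h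
  refine Finite.of_injective (β := ({M : NDMatrix | M.size ≤ A.size} ×ˢ
    {M : NDMatrix | M.size ≤ A.size} : Set (NDMatrix × NDMatrix)))
    (fun p => ⟨p.1, ?_⟩) (fun p q e => Subtype.ext (Subtype.mk.inj e))
  obtain ⟨⟨B, C⟩, rfl⟩ := p
  exact ⟨Nat.le_mul_of_pos_right _ C.size_pos, Nat.le_mul_of_pos_left _ B.size_pos⟩

instance (A : NDMatrix) : Fintype A.Factorization := Fintype.ofFinite _

end NDMatrix

/-! ### Cuntz-Krieger algebras -/

/-- The free unital complex `*`-algebra on a set `X`; the generator `Sum.inr x` is the adjoint of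
the generator `Sum.inl x`. -/
def FreeStarAlgebra (X : Type) : Type := FreeAlgebra ℂ (X ⊕ X)

namespace FreeStarAlgebra

variable {X : Type}

instance : Ring (FreeStarAlgebra X) := inferInstanceAs (Ring (FreeAlgebra ℂ (X ⊕ X)))
instance : Algebra ℂ (FreeStarAlgebra X) := inferInstanceAs (Algebra ℂ (FreeAlgebra ℂ (X ⊕ X)))

/-- The generator indexed by `x`, or its adjoint. -/
def gen (x : X ⊕ X) : FreeStarAlgebra X := FreeAlgebra.ι ℂ x

/-- The homomorphism of unital complex algebras that is given by its values on the generators. -/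
def evalAux {D : Type v} [Ring D] [Algebra ℂ D] (f : X ⊕ X → D) : FreeStarAlgebra X →ₐ[ℂ] D :=
  FreeAlgebra.lift ℂ f

theorem evalAux_gen {D : Type v} [Ring D] [Algebra ℂ D] (f : X ⊕ X → D) (x : X ⊕ X) :
    evalAux f (gen x) = f x := FreeAlgebra.lift_ι_apply f x

theorem induction {q : FreeStarAlgebra X → Prop} (h_scalar : ∀ r, q (algebraMap ℂ _ r))
    (h_gen : ∀ x, q (gen x)) (h_mul : ∀ a b, q a → q b → q (a * b))
    (h_add : ∀ a b, q a → q b → q (a + b)) (a : FreeStarAlgebra X) : q a :=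
  FreeAlgebra.induction ℂ (X ⊕ X) (motive := q) h_scalar h_gen h_mul h_add a

/-- The conjugate-linear antiautomorphism that exchanges the generators and their adjoints. -/
def starAux : FreeStarAlgebra X →+* (FreeStarAlgebra X)ᵐᵒᵖ :=
  letI : Algebra ℂ (FreeStarAlgebra X)ᵐᵒᵖ :=
    Algebra.compHom (FreeStarAlgebra X)ᵐᵒᵖ (starRingEnd ℂ)
  (evalAux fun x => MulOpposite.op (gen x.swap)).toRingHom

theorem starAux_gen (x : X ⊕ X) : starAux (gen x) = MulOpposite.op (gen x.swap) :=
  letI : Algebra ℂ (FreeStarAlgebra X)ᵐᵒᵖ :=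
    Algebra.compHom (FreeStarAlgebra X)ᵐᵒᵖ (starRingEnd ℂ)
  evalAux_gen (fun x => MulOpposite.op (gen x.swap)) x

theorem starAux_algebraMap (r : ℂ) : starAux (algebraMap ℂ (FreeStarAlgebra X) r)
    = MulOpposite.op (algebraMap ℂ (FreeStarAlgebra X) (starRingEnd ℂ r)) :=
  letI : Algebra ℂ (FreeStarAlgebra X)ᵐᵒᵖ :=
    Algebra.compHom (FreeStarAlgebra X)ᵐᵒᵖ (starRingEnd ℂ)
  (evalAux fun x : X ⊕ X => MulOpposite.op (gen x.swap)).commutes r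

instance : StarRing (FreeStarAlgebra X) where
  star a := (starAux a).unop
  star_involutive a := by
    induction a using induction with
    | h_scalar r => simp [starAux_algebraMap]
    | h_gen x => simp [starAux_gen]
    | h_mul a b ha hb => simp [ha, hb]
    | h_add a b ha hb => simp [ha, hb]
  star_mul a b := by simp
  star_add a b := by simp

theorem star_gen (x : X ⊕ X) : star (gen x) = gen x.swap := by
  change (starAux (gen x)).unop = _
  rw [starAux_gen]; rfl

theorem star_algebraMap (r : ℂ) : star (algebraMap ℂ (FreeStarAlgebra X) r)
    = algebraMap ℂ (FreeStarAlgebra X) (star r) := by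
  change (starAux _).unop = _
  rw [starAux_algebraMap]; rfl

instance : StarModule ℂ (FreeStarAlgebra X) where
  star_smul r a := by
    rw [Algebra.smul_def, star_mul, star_algebraMap, Algebra.smul_def, Algebra.commutes]

/-- The unital `*`-homomorphism that maps the generator `x` to `s x`. -/
def eval {D : Type v} [Ring D] [StarRing D] [Algebra ℂ D] [StarModule ℂ D] (s : X → D) :
    FreeStarAlgebra X →⋆ₐ[ℂ] D where
  __ := evalAux (Sum.elim s fun x => star (s x))
  map_star' a := by
    change evalAux _ _ = star (evalAux _ _)
    induction a using induction with
    | h_scalar r => rw [star_algebraMap, AlgHom.commutes, AlgHom.commutes, algebraMap_star_comm]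
    | h_gen x => cases x <;> simp [star_gen, evalAux_gen]
    | h_mul a b ha hb => rw [star_mul, map_mul, map_mul, star_mul, ha, hb]
    | h_add a b ha hb => rw [star_add, map_add, map_add, star_add, ha, hb]

theorem eval_gen {D : Type v} [Ring D] [StarRing D] [Algebra ℂ D] [StarModule ℂ D] (s : X → D)
    (x : X) : eval s (gen (Sum.inl x)) = s x := evalAux_gen _ _

end FreeStarAlgebra

/-- Partial isometries `s_1, …, s_n` in a unital C*-algebra that satisfy the Cuntz-Krieger
relations of the matrix `A`. For the matrix `1` of size one the additional relation `s_1 = 1` is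
imposed, by the convention that the algebra of this matrix is `ℂ` with generator `1`. -/
structure CKFamily (A : NDMatrix) (D : Type v) [CStarAlgebra D] where
  s : Fin A.size → D
  partial_isometry : ∀ i, s i * star (s i) * s i = s i
  star_mul_self : ∀ i, star (s i) * s i = ∑ j, A.mat i j • (s j * star (s j))
  sum_mul_star : ∑ i, s i * star (s i) = 1
  eq_one : A.size = 1 → ∀ i, s i = 1

theorem CKFamily.norm_le_one {A : NDMatrix} {D : Type v} [CStarAlgebra D] (F : CKFamily A D)
    (i : Fin A.size) : ‖F.s i‖ ≤ 1 := by
  have h1 : ‖F.s i‖ * ‖F.s i‖ = ‖star (F.s i) * F.s i‖ := CStarRing.norm_star_mul_self.symm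
  have h2 : star (star (F.s i) * F.s i) * (star (F.s i) * F.s i) = star (F.s i) * F.s i := by
    rw [star_mul, star_star, mul_assoc, ← mul_assoc (F.s i), F.partial_isometry]
  have h3 : ‖star (F.s i) * F.s i‖ * ‖star (F.s i) * F.s i‖ = ‖star (F.s i) * F.s i‖ := by
    rw [← CStarRing.norm_star_mul_self, h2]
  rw [← h1] at h3
  have h4 := norm_nonneg (F.s i)
  by_contra hlt
  have h5 : 1 < ‖F.s i‖ * ‖F.s i‖ := by nlinarith
  nlinarith

/-- A Cuntz-Krieger family in some unital C*-algebra. -/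
structure CKRep (A : NDMatrix) where
  D : Type
  [cstar : CStarAlgebra D]
  fam : CKFamily A D

attribute [instance] CKRep.cstar

namespace CKRep

variable {A : NDMatrix}

instance : Nonempty (CKRep A) :=
  ⟨{ D := EuclideanSpace ℂ PEmpty →L[ℂ] EuclideanSpace ℂ PEmpty
     fam :=
      { s := 0
        partial_isometry := fun _ => Subsingleton.elim _ _
        star_mul_self := fun _ => Subsingleton.elim _ _
        sum_mul_star := Subsingleton.elim _ _
        eq_one := fun _ _ => Subsingleton.elim _ _ } }⟩

/-- The evaluation of `*`-polynomials on a Cuntz-Krieger family. -/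
def eval (r : CKRep A) : FreeStarAlgebra (Fin A.size) →⋆ₙₐ[ℂ] r.D :=
  (FreeStarAlgebra.eval r.fam.s).toNonUnitalStarAlgHom

theorem norm_eval_bdd (x : FreeStarAlgebra (Fin A.size)) : ∃ C, ∀ r : CKRep A, ‖r.eval x‖ ≤ C := by
  induction x using FreeStarAlgebra.induction with
  | h_scalar c =>
    refine ⟨‖c‖, fun r => ?_⟩
    change ‖FreeStarAlgebra.eval r.fam.s _‖ ≤ _
    rw [AlgHomClass.commutes, norm_algebraMap]
    refine mul_le_of_le_one_right (norm_nonneg _) ?_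
    rcases subsingleton_or_nontrivial r.D with h | h
    · rw [Subsingleton.elim (1 : r.D) 0, norm_zero]; exact zero_le_one
    · exact CStarRing.norm_one.le
  | h_gen x =>
    refine ⟨1, fun r => ?_⟩
    cases x with
    | inl i =>
      change ‖FreeStarAlgebra.evalAux _ _‖ ≤ _
      rw [FreeStarAlgebra.evalAux_gen]; exact r.fam.norm_le_one i
    | inr i =>
      change ‖FreeStarAlgebra.evalAux _ _‖ ≤ _
      rw [FreeStarAlgebra.evalAux_gen, Sum.elim_inr, norm_star]; exact r.fam.norm_le_one i
  | h_mul a b ha hb =>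
    obtain ⟨C, hC⟩ := ha
    obtain ⟨D, hD⟩ := hb
    exact ⟨C * D, fun r => by
      rw [map_mul]
      exact (norm_mul_le _ _).trans
        (mul_le_mul (hC r) (hD r) (norm_nonneg _) ((norm_nonneg _).trans (hC r)))⟩
  | h_add a b ha hb =>
    obtain ⟨C, hC⟩ := ha
    obtain ⟨D, hD⟩ := hb
    exact ⟨C + D, fun r => by
      rw [map_add]; exact (norm_add_le _ _).trans (add_le_add (hC r) (hD r))⟩

end CKRep

/-- The universal C*-seminorm on `*`-polynomials: the supremum over all Cuntz-Krieger families. -/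
def ckSeminorm (A : NDMatrix) : CStarSeminorm (FreeStarAlgebra (Fin A.size)) :=
  CStarSeminorm.ofHoms (fun r : CKRep A => r.eval) CKRep.norm_eval_bdd

/-- The Cuntz-Krieger algebra `𝒪_A`: the universal unital C*-algebra generated by a Cuntz-Krieger
family of the matrix `A`. -/
def CKAlgebra (A : NDMatrix) : Type := (ckSeminorm A).Compl

namespace CKAlgebra

/-- The C*-algebra structure of the Cuntz-Krieger algebra. -/
def cstarAlgebra (A : NDMatrix) : CStarAlgebra (CKAlgebra A) :=
  CStarAlgebra.ofUnit (E := (ckSeminorm A).Compl) ((ckSeminorm A).toCompl 1)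
    (fun x => (ckSeminorm A).denseRange_toCompl.induction_on
      (p := fun x => (ckSeminorm A).toCompl 1 * x = x) x
      (isClosed_eq (continuous_const_mul _) continuous_id)
      fun a => by rw [← map_mul, one_mul])
    (fun x => (ckSeminorm A).denseRange_toCompl.induction_on
      (p := fun x => x * (ckSeminorm A).toCompl 1 = x) x
      (isClosed_eq (continuous_mul_const _) continuous_id)
      fun a => by rw [← map_mul, mul_one])

instance (A : NDMatrix) : CStarAlgebra (CKAlgebra A) := cstarAlgebra A

/-- The image of a `*`-polynomial in the generators. -/
def ofFree (A : NDMatrix) : FreeStarAlgebra (Fin A.size) →⋆ₐ[ℂ] CKAlgebra A :=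
  let f : FreeStarAlgebra (Fin A.size) →⋆ₙₐ[ℂ] CKAlgebra A := (ckSeminorm A).toCompl
  { toFun := f
    map_one' := rfl
    map_mul' := map_mul f
    map_zero' := map_zero f
    map_add' := map_add f
    commutes' := fun r => by
      rw [Algebra.algebraMap_eq_smul_one, map_smul, Algebra.algebraMap_eq_smul_one]; rfl
    map_star' := map_star f }

variable {A : NDMatrix}

theorem norm_ofFree (x : FreeStarAlgebra (Fin A.size)) :
    ‖ofFree A x‖ = ⨆ r : CKRep A, ‖FreeStarAlgebra.eval r.fam.s x‖ :=
  (ckSeminorm A).norm_toCompl x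

theorem denseRange_ofFree : DenseRange (ofFree A) := (ckSeminorm A).denseRange_toCompl

/-- The canonical generators. -/
def gen (A : NDMatrix) (i : Fin A.size) : CKAlgebra A :=
  ofFree A (FreeStarAlgebra.gen (Sum.inl i))

theorem eq_of_eval {x y : FreeStarAlgebra (Fin A.size)}
    (h : ∀ r : CKRep A, FreeStarAlgebra.eval r.fam.s x = FreeStarAlgebra.eval r.fam.s y) :
    ofFree A x = ofFree A y := by
  rw [← sub_eq_zero, ← map_sub, ← norm_eq_zero, norm_ofFree]
  simp [map_sub, h]

/-- The generators form a Cuntz-Krieger family. -/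
def canonicalFamily (A : NDMatrix) : CKFamily A (CKAlgebra A) where
  s := gen A
  partial_isometry i := by
    simp only [gen, ← map_mul, ← map_star]
    exact eq_of_eval fun r => by
      simp only [map_mul, map_star, FreeStarAlgebra.eval_gen, r.fam.partial_isometry]
  star_mul_self i := by
    simp only [gen, ← map_mul, ← map_star, ← map_sum, ← map_nsmul]
    exact eq_of_eval fun r => by
      simp only [map_mul, map_star, map_sum, map_nsmul, FreeStarAlgebra.eval_gen,
        r.fam.star_mul_self]
  sum_mul_star := by
    simp only [gen, ← map_mul, ← map_star, ← map_sum]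
    rw [← map_one (ofFree A)]
    exact eq_of_eval fun r => by
      simp only [map_mul, map_star, map_sum, map_one, FreeStarAlgebra.eval_gen,
        r.fam.sum_mul_star]
  eq_one h i := by
    rw [gen, ← map_one (ofFree A)]
    exact eq_of_eval fun r => by
      simp only [map_one, FreeStarAlgebra.eval_gen, r.fam.eq_one h i]

section lift

variable {D : Type} [CStarAlgebra D] (F : CKFamily A D)

theorem norm_eval_le (x : FreeStarAlgebra (Fin A.size)) :
    ‖(FreeStarAlgebra.eval F.s).toNonUnitalStarAlgHom x‖ ≤ (ckSeminorm A).toSeminorm x :=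
  CStarSeminorm.le_ofHoms (fun r : CKRep A => r.eval) CKRep.norm_eval_bdd { D := D, fam := F } x

/-- The universal property: a Cuntz-Krieger family in `D` gives a unital `*`-homomorphism. -/
def lift : CKAlgebra A →⋆ₐ[ℂ] D :=
  let f : CKAlgebra A →⋆ₙₐ[ℂ] D :=
    CStarSeminorm.lift (FreeStarAlgebra.eval F.s).toNonUnitalStarAlgHom (norm_eval_le F)
  have h1 : f 1 = 1 := (CStarSeminorm.lift_toCompl _ (norm_eval_le F) 1).trans
    (map_one (FreeStarAlgebra.eval F.s))
  { toFun := f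
    map_one' := h1
    map_mul' := map_mul f
    map_zero' := map_zero f
    map_add' := map_add f
    commutes' := fun r => by
      rw [Algebra.algebraMap_eq_smul_one, map_smul, h1, Algebra.algebraMap_eq_smul_one]
    map_star' := map_star f }

theorem lift_ofFree (x : FreeStarAlgebra (Fin A.size)) :
    lift F (ofFree A x) = FreeStarAlgebra.eval F.s x :=
  CStarSeminorm.lift_toCompl _ (norm_eval_le F) x

theorem lift_gen (i : Fin A.size) : lift F (gen A i) = F.s i :=
  (lift_ofFree F _).trans (FreeStarAlgebra.eval_gen F.s i)

end lift

attribute [irreducible] cstarAlgebra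

/-- Transport along an equality of matrices. -/
def cast {A A' : NDMatrix} (h : A = A') : CKAlgebra A →⋆ₙₐ[ℂ] CKAlgebra A' :=
  h ▸ NonUnitalStarAlgHom.id ℂ (CKAlgebra A)

theorem cast_rfl (x : CKAlgebra A) : cast rfl x = x := rfl

/-- The family consisting of the number `1` in `ℂ`. -/
def oneFamily : CKFamily NDMatrix.one ℂ where
  s _ := 1
  partial_isometry i := by simp
  star_mul_self i := by
    change star (1 : ℂ) * 1 = ∑ _j : Fin 1, 1 • ((1 : ℂ) * star 1)
    simp
  sum_mul_star := by
    change ∑ _j : Fin 1, ((1 : ℂ) * star 1) = 1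
    simp
  eq_one h i := rfl

/-- The identification of the algebra of the matrix `1` with `ℂ`; the generator is mapped
to `1`. -/
def evalOne : CKAlgebra NDMatrix.one →⋆ₐ[ℂ] ℂ := lift oneFamily

theorem algebraMap_evalOne (x : CKAlgebra NDMatrix.one) :
    algebraMap ℂ (CKAlgebra NDMatrix.one) (evalOne x) = x := by
  have hc : Continuous evalOne := continuous_starHom evalOne.toNonUnitalStarAlgHom
  refine congrFun (denseRange_ofFree.equalizer ((continuous_algebraMap ℂ _).comp hc)
    continuous_id (funext fun a => ?_)) x
  change algebraMap ℂ (CKAlgebra NDMatrix.one) (evalOne (ofFree _ a)) = ofFree _ a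
  induction a using FreeStarAlgebra.induction with
  | h_scalar r => simp [AlgHomClass.commutes]
  | h_gen x =>
    have h1 : ∀ i, gen NDMatrix.one i = 1 := (canonicalFamily NDMatrix.one).eq_one rfl
    cases x with
    | inl i =>
      change algebraMap ℂ _ (evalOne (gen _ i)) = gen _ i
      rw [h1, map_one, map_one]
    | inr i =>
      have : FreeStarAlgebra.gen (Sum.inr i) = star (FreeStarAlgebra.gen (Sum.inl i)) :=
        (FreeStarAlgebra.star_gen (Sum.inl i)).symm
      rw [this, map_star]
      change algebraMap ℂ _ (evalOne (star (gen _ i))) = star (gen _ i)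
      rw [h1, star_one, map_one, map_one]
  | h_mul a b ha hb => rw [map_mul, map_mul, map_mul, ha, hb]
  | h_add a b ha hb => rw [map_add, map_add, map_add, ha, hb]

end CKAlgebra

/-! ### The embeddings `φ_{B,C}` -/

namespace MinTensor

variable {A B : Type u} [NonUnitalCStarAlgebra A] [NonUnitalCStarAlgebra B]

theorem sum_tmul_sum {ι κ : Type*} (s : Finset ι) (t : Finset κ) (a : ι → A) (b : κ → B) :
    (∑ i ∈ s, a i) ⊗ₑ (∑ j ∈ t, b j) = ∑ i ∈ s, ∑ j ∈ t, a i ⊗ₑ b j := by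
  simp only [tmul, TensorProduct.sum_tmul, TensorProduct.tmul_sum, map_sum]
  exact Finset.sum_comm

theorem nsmul_tmul_nsmul (m n : ℕ) (a : A) (b : B) :
    (m • a) ⊗ₑ (n • b) = (m * n) • (a ⊗ₑ b) := by
  simp only [tmul, ← Nat.cast_smul_eq_nsmul ℂ, TensorProduct.smul_tmul_smul, map_smul]
  push_cast
  rfl

end MinTensor

section tensorFamily

variable (B C : NDMatrix)

/-- The elementary tensor of generators that corresponds to the index `k`. -/
def tensorGen (k : Fin (B.size * C.size)) : CKAlgebra B ⊗min CKAlgebra C :=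
  CKAlgebra.gen B k.divNat ⊗ₑ CKAlgebra.gen C k.modNat

theorem tensorGen_apply (i : Fin B.size) (j : Fin C.size) :
    tensorGen B C (finProdFinEquiv (i, j)) = CKAlgebra.gen B i ⊗ₑ CKAlgebra.gen C j := by
  have h := finProdFinEquiv.symm_apply_apply (i, j)
  have h1 : (finProdFinEquiv (i, j)).divNat = i := congrArg Prod.fst h
  have h2 : (finProdFinEquiv (i, j)).modNat = j := congrArg Prod.snd h
  rw [tensorGen, h1, h2]

theorem tensorGen_partial_isometry (k : Fin (B.size * C.size)) :
    tensorGen B C k * star (tensorGen B C k) * tensorGen B C k = tensorGen B C k := by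
  have hB := (CKAlgebra.canonicalFamily B).partial_isometry k.divNat
  have hC := (CKAlgebra.canonicalFamily C).partial_isometry k.modNat
  simp only [tensorGen, MinTensor.star_tmul, MinTensor.tmul_mul_tmul]
  exact congrArg₂ MinTensor.tmul hB hC

theorem tensorGen_star_mul_self (k : Fin (B.size * C.size)) :
    star (tensorGen B C k) * tensorGen B C k =
      ∑ l, (B ⊠ C).mat k l • (tensorGen B C l * star (tensorGen B C l)) := by
  have hB := (CKAlgebra.canonicalFamily B).star_mul_self k.divNat
  have hC := (CKAlgebra.canonicalFamily C).star_mul_self k.modNat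
  refine Eq.trans ?_ (finProdFinEquiv.sum_comp fun l =>
    (B ⊠ C).mat k l • (tensorGen B C l * star (tensorGen B C l)))
  rw [Fintype.sum_prod_type, tensorGen, MinTensor.star_tmul, MinTensor.tmul_mul_tmul]
  refine (congrArg₂ MinTensor.tmul hB hC).trans ?_
  rw [MinTensor.sum_tmul_sum]
  refine Finset.sum_congr rfl fun i _ => Finset.sum_congr rfl fun j _ => ?_
  rw [MinTensor.nsmul_tmul_nsmul, tensorGen_apply, MinTensor.star_tmul, MinTensor.tmul_mul_tmul]
  have h : (B ⊠ C).mat k (finProdFinEquiv (i, j)) = B.mat k.divNat i * C.mat k.modNat j := by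
    have := NDMatrix.kron_mat B C k.divNat i k.modNat j
    rwa [show finProdFinEquiv (k.divNat, k.modNat) = k from
      finProdFinEquiv.apply_symm_apply k] at this
  rw [h]
  rfl

theorem tensorGen_sum : ∑ k, tensorGen B C k * star (tensorGen B C k) = 1 ⊗ₑ 1 := by
  have hB := (CKAlgebra.canonicalFamily B).sum_mul_star
  have hC := (CKAlgebra.canonicalFamily C).sum_mul_star
  refine (finProdFinEquiv.sum_comp fun l =>
    tensorGen B C l * star (tensorGen B C l)).symm.trans ?_
  rw [Fintype.sum_prod_type, ← hB, ← hC, MinTensor.sum_tmul_sum]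
  refine Finset.sum_congr rfl fun i _ => Finset.sum_congr rfl fun j _ => ?_
  rw [tensorGen_apply, MinTensor.star_tmul, MinTensor.tmul_mul_tmul]
  rfl

theorem tensorGen_eq_one (h : (B ⊠ C).size = 1) (k : Fin (B.size * C.size)) :
    tensorGen B C k = 1 ⊗ₑ 1 :=
  have h' : B.size * C.size = 1 := h
  congrArg₂ MinTensor.tmul
    ((CKAlgebra.canonicalFamily B).eq_one (Nat.dvd_one.1 (h' ▸ Dvd.intro _ rfl)) _)
    ((CKAlgebra.canonicalFamily C).eq_one (Nat.dvd_one.1 (h' ▸ Dvd.intro_left _ rfl)) _)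

/-- The elements `s_i ⊗ s_j` form a Cuntz-Krieger family of the matrix `B ⊠ C`. -/
def tensorFamily :
    @CKFamily (B ⊠ C) (CKAlgebra B ⊗min CKAlgebra C) MinTensor.cstarAlgebra :=
  letI : CStarAlgebra (CKAlgebra B ⊗min CKAlgebra C) := MinTensor.cstarAlgebra
  { s := tensorGen B C
    partial_isometry := tensorGen_partial_isometry B C
    star_mul_self := tensorGen_star_mul_self B C
    sum_mul_star := tensorGen_sum B C
    eq_one := tensorGen_eq_one B C }

end tensorFamily

/-- The unital `*`-homomorphism `φ_{B,C} : 𝒪_{B ⊠ C} → 𝒪_B ⊗ 𝒪_C` that maps each generator to the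
corresponding elementary tensor of generators. -/
def phi (B C : NDMatrix) : CKAlgebra (B ⊠ C) →⋆ₙₐ[ℂ] CKAlgebra B ⊗min CKAlgebra C :=
  letI : CStarAlgebra (CKAlgebra B ⊗min CKAlgebra C) := MinTensor.cstarAlgebra
  (CKAlgebra.lift (tensorFamily B C)).toNonUnitalStarAlgHom

theorem phi_one (B C : NDMatrix) : phi B C 1 = 1 ⊗ₑ 1 :=
  letI : CStarAlgebra (CKAlgebra B ⊗min CKAlgebra C) := MinTensor.cstarAlgebra
  map_one (CKAlgebra.lift (tensorFamily B C))

theorem phi_gen (B C : NDMatrix) (i : Fin B.size) (j : Fin C.size) :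
    phi B C (CKAlgebra.gen (B ⊠ C) (finProdFinEquiv (i, j)))
      = CKAlgebra.gen B i ⊗ₑ CKAlgebra.gen C j := by
  let : CStarAlgebra (CKAlgebra B ⊗min CKAlgebra C) := MinTensor.cstarAlgebra
  exact (CKAlgebra.lift_gen (tensorFamily B C) (finProdFinEquiv (i, j))).trans
    (tensorGen_apply B C i j)

/-! ### The comultiplication and the counit -/

/-- The direct sum of all Cuntz-Krieger algebras of nondegenerate `0`-`1` matrices. -/
abbrev CKSum : Type := C0Sum CKAlgebra

/-- The map `φ_{B,C}` with values in the tensor square of the direct sum. -/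
def phiSum (B C : NDMatrix) : CKAlgebra (B ⊠ C) →⋆ₙₐ[ℂ] CKSum ⊗min CKSum :=
  (MinTensor.map (C0Sum.of CKAlgebra B) (C0Sum.of CKAlgebra C)).comp (phi B C)

theorem MinTensor.map_of_mul_map_of {B C B' C' : NDMatrix} (h : (B, C) ≠ (B', C'))
    (x : CKAlgebra B ⊗min CKAlgebra C) (y : CKAlgebra B' ⊗min CKAlgebra C') :
    MinTensor.map (C0Sum.of CKAlgebra B) (C0Sum.of CKAlgebra C) x *
      MinTensor.map (C0Sum.of CKAlgebra B') (C0Sum.of CKAlgebra C') y = 0 := by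
  have hc : ∀ B C, Continuous
    (MinTensor.map (C0Sum.of CKAlgebra B) (C0Sum.of CKAlgebra C)) := fun B C =>
    continuous_starHom _
  refine MinTensor.ext_of_continuous
    (f := (AddMonoidHom.mulRight (MinTensor.map (C0Sum.of CKAlgebra B')
      (C0Sum.of CKAlgebra C') y)).comp
      (AddMonoidHomClass.toAddMonoidHom
        (MinTensor.map (C0Sum.of CKAlgebra B) (C0Sum.of CKAlgebra C))))
    (g := 0) ((continuous_mul_const _).comp (hc B C)) continuous_const (fun a b => ?_) x
  refine MinTensor.ext_of_continuous
    (f := (AddMonoidHom.mulLeft (MinTensor.map (C0Sum.of CKAlgebra B)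
      (C0Sum.of CKAlgebra C) (a ⊗ₑ b))).comp
      (AddMonoidHomClass.toAddMonoidHom
        (MinTensor.map (C0Sum.of CKAlgebra B') (C0Sum.of CKAlgebra C'))))
    (g := 0) ((continuous_const_mul _).comp (hc B' C')) continuous_const (fun a' b' => ?_) y
  change MinTensor.map _ _ (a ⊗ₑ b) * MinTensor.map _ _ (a' ⊗ₑ b') = 0
  rw [MinTensor.map_tmul, MinTensor.map_tmul, MinTensor.tmul_mul_tmul]
  by_cases hB : B = B'
  · have hC : C ≠ C' := fun hC => h (by rw [hB, hC])
    rw [C0Sum.of_mul_of_ne hC, MinTensor.tmul, TensorProduct.tmul_zero, map_zero]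
  · rw [C0Sum.of_mul_of_ne hB, MinTensor.tmul, TensorProduct.zero_tmul, map_zero]

theorem phiSum_mul_of_ne {B C B' C' : NDMatrix} (h : (B, C) ≠ (B', C'))
    (x : CKAlgebra (B ⊠ C)) (y : CKAlgebra (B' ⊠ C')) : phiSum B C x * phiSum B' C' y = 0 :=
  MinTensor.map_of_mul_map_of h _ _

/-- The map `Δ^{(A)} = ∑ φ_{B,C}`, the sum over all factorizations `B ⊠ C = A`. -/
def comulComponent (A : NDMatrix) : CKAlgebra A →⋆ₙₐ[ℂ] CKSum ⊗min CKSum where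
  toFun x := ∑ p : A.Factorization, phiSum p.1.1 p.1.2 (CKAlgebra.cast p.2.symm x)
  map_smul' c x := by simp [Finset.smul_sum]
  map_zero' := by simp
  map_add' x y := by simp [Finset.sum_add_distrib]
  map_mul' x y := by
    rw [Finset.sum_mul_sum]
    refine Finset.sum_congr rfl fun p _ => ?_
    rw [map_mul, map_mul]
    refine (Finset.sum_eq_single
      (f := fun q : A.Factorization => phiSum p.1.1 p.1.2 (CKAlgebra.cast p.2.symm x) *
        phiSum q.1.1 q.1.2 (CKAlgebra.cast q.2.symm y)) p (fun q _ hq => ?_)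
      fun h => absurd (Finset.mem_univ p) h).symm
    exact phiSum_mul_of_ne (fun e => hq (Subtype.ext e.symm)) _ _
  map_star' x := by rw [star_sum]; exact Finset.sum_congr rfl fun p _ => by rw [map_star, map_star]

theorem comulComponent_apply (A : NDMatrix) (x : CKAlgebra A) : comulComponent A x =
    ∑ p : A.Factorization, phiSum p.1.1 p.1.2 (CKAlgebra.cast p.2.symm x) := rfl

theorem comulComponent_mul_of_ne (A A' : NDMatrix) (h : A ≠ A') (x : CKAlgebra A)
    (y : CKAlgebra A') : comulComponent A x * comulComponent A' y = 0 := by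
  rw [comulComponent_apply, comulComponent_apply, Finset.sum_mul_sum]
  refine Finset.sum_eq_zero fun p _ => Finset.sum_eq_zero fun q _ =>
    phiSum_mul_of_ne (fun e => h ?_) _ _
  have e' : p.1 = q.1 := e
  rw [← p.2, ← q.2, e']

/-- The comultiplication `Δ_φ`, the direct sum of the maps `Δ^{(A)}`. -/
def comul : CKSum →⋆ₙₐ[ℂ] CKSum ⊗min CKSum :=
  C0Sum.lift comulComponent comulComponent_mul_of_ne

theorem comul_of (A : NDMatrix) (x : CKAlgebra A) :
    comul (C0Sum.of CKAlgebra A x) =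
      ∑ p : A.Factorization, phiSum p.1.1 p.1.2 (CKAlgebra.cast p.2.symm x) :=
  C0Sum.lift_of comulComponent comulComponent_mul_of_ne A x

/-- The counit `ε`: the projection onto the summand of the matrix `1`, which is `ℂ`. -/
def counit : CKSum →⋆ₙₐ[ℂ] ℂ :=
  CKAlgebra.evalOne.toNonUnitalStarAlgHom.comp (C0Sum.proj CKAlgebra NDMatrix.one)

theorem counit_of_one (x : CKAlgebra NDMatrix.one) :
    counit (C0Sum.of CKAlgebra NDMatrix.one x) = CKAlgebra.evalOne x :=
  congrArg CKAlgebra.evalOne (C0Sum.proj_of_self _ x)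

theorem counit_of_ne (A : NDMatrix) (h : A ≠ NDMatrix.one) (x : CKAlgebra A) :
    counit (C0Sum.of CKAlgebra A x) = 0 :=
  (congrArg CKAlgebra.evalOne (C0Sum.proj_of_ne h.symm x)).trans (map_zero _)

/-! ### C*-bialgebras -/

/-- A strictly proper C*-bialgebra: a C*-algebra `𝒜` with a comultiplication `Δ` that takes its
values in the minimal tensor product `𝒜 ⊗ 𝒜` (and not only in its multiplier algebra) such that the
elements `Δ(a)(b ⊗ c)` span a dense subspace of `𝒜 ⊗ 𝒜` and `(Δ ⊗ id) ∘ Δ = (id ⊗ Δ) ∘ Δ`, where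
`(𝒜 ⊗ 𝒜) ⊗ 𝒜` and `𝒜 ⊗ (𝒜 ⊗ 𝒜)` are identified through the `*`-isomorphism
`(a ⊗ b) ⊗ c ↦ a ⊗ (b ⊗ c)`, which is unique by continuity. -/
structure IsStrictlyProperBialgebra {𝒜 : Type u} [NonUnitalCStarAlgebra 𝒜]
    (Δ : 𝒜 →⋆ₙₐ[ℂ] 𝒜 ⊗min 𝒜) : Prop where
  dense_span : Dense
    (Submodule.span ℂ {z : 𝒜 ⊗min 𝒜 | ∃ a b c : 𝒜, z = Δ a * (b ⊗ₑ c)} : Set (𝒜 ⊗min 𝒜))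
  coassoc : ∃ α : (𝒜 ⊗min 𝒜) ⊗min 𝒜 ≃⋆ₐ[ℂ] 𝒜 ⊗min (𝒜 ⊗min 𝒜),
    (∀ a b c : 𝒜, α ((a ⊗ₑ b) ⊗ₑ c) = a ⊗ₑ (b ⊗ₑ c)) ∧
    ∀ x : 𝒜, α (MinTensor.map Δ (NonUnitalStarAlgHom.id ℂ 𝒜) (Δ x)) =
      MinTensor.map (NonUnitalStarAlgHom.id ℂ 𝒜) Δ (Δ x)

/-- The counit property `(ε ⊗ id) ∘ Δ ≅ id ≅ (id ⊗ ε) ∘ Δ`, where `x : 𝒜` is identified with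
`1 ⊗ x` in `ℂ ⊗ 𝒜` and with `x ⊗ 1` in `𝒜 ⊗ ℂ`. -/
structure IsCounit {𝒜 : Type} [NonUnitalCStarAlgebra 𝒜]
    (Δ : 𝒜 →⋆ₙₐ[ℂ] 𝒜 ⊗min 𝒜) (ε : 𝒜 →⋆ₙₐ[ℂ] ℂ) : Prop where
  left : ∀ x : 𝒜, MinTensor.map ε (NonUnitalStarAlgHom.id ℂ 𝒜) (Δ x) = (1 : ℂ) ⊗ₑ x
  right : ∀ x : 𝒜, MinTensor.map (NonUnitalStarAlgHom.id ℂ 𝒜) ε (Δ x) = x ⊗ₑ (1 : ℂ)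

/-!
The counit, density and coassociativity properties of `Δ_φ` are computations with generators,
once the minimal tensor product is known to be associative.

Associativity. The minimal norm is a supremum over all pairs of representations, so the norm of
`(A ⊗ B) ⊗ C` involves representations of `A ⊗ B` that are not of the form `ρ ⊗ σ`. They do not
enlarge the norm: if a family `r_i` of representations of `A` is jointly faithful, then
`‖(ρ ⊗ σ)(t)‖ ≤ sup_i ‖(r_i ⊗ σ)(t)‖` for all `ρ`, `σ` and `t`
(`HilbertRep.norm_tensor_le_of_forall`). To see this, compress the second factor by the projection
onto a finite-dimensional subspace of the space of `σ`; the compressed operator is the image of a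
matrix over `A` that depends on `σ` and `t` but not on `ρ`, and on the C*-algebra of matrices over
`A` the jointly faithful family is isometric, since injective `*`-homomorphisms are. The
representations `ρ ⊗ σ` are jointly faithful on `A ⊗ B`, so both norms on `(A ⊙ B) ⊙ C` are the
supremum over triples of representations, and the associator extends by continuity
(`MinTensor.exists_assoc`).

The bialgebra. Homomorphisms on a Cuntz-Krieger algebra are determined by the generators
(`CKAlgebra.hom_ext`). Both `(Δ ⊗ id) ∘ Δ` and `(id ⊗ Δ) ∘ Δ` restrict on `𝒪_A` to a sum over the
factorizations of `A` in three factors, as the Kronecker product is associative, and corresponding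
terms agree on generators (`assoc_phiLeft`). The counit selects the factorizations with a trivial
factor. Density follows from `Δ(1_{B ⊠ C}) (b ⊗ c) = b ⊗ c`, where `1_{B ⊠ C}` is the unit of
`𝒪_{B ⊠ C}`. A unit of the direct sum would have norm `1` in every nonzero summand, and there are
infinitely many: the algebra of each identity matrix has a character.
-/

/-! ### Operators on Hilbert space tensor products -/

namespace HTensor

variable {H K H' K' H'' K'' : Type u} [NormedAddCommGroup H] [InnerProductSpace ℂ H]
  [NormedAddCommGroup K] [InnerProductSpace ℂ K] [NormedAddCommGroup H'] [InnerProductSpace ℂ H']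
  [NormedAddCommGroup K'] [InnerProductSpace ℂ K'] [NormedAddCommGroup H'']
  [InnerProductSpace ℂ H''] [NormedAddCommGroup K''] [InnerProductSpace ℂ K'']

theorem map_comp_map (S : H' →L[ℂ] H'') (T : K' →L[ℂ] K'') (S' : H →L[ℂ] H') (T' : K →L[ℂ] K') :
    (map S T).comp (map S' T') = map (S.comp S') (T.comp T') :=
  ext fun h k => by simp [map_tmul]

theorem map_mul_map (S S' : H →L[ℂ] H) (T T' : K →L[ℂ] K) :
    map S T * map S' T' = map (S * S') (T * T') := map_comp_map S T S' T'

/-- The bounded operator `S ⊗ T`, as a bilinear function of `S` and `T`. -/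
def mapBilin : (H →L[ℂ] H') →ₗ[ℂ] (K →L[ℂ] K') →ₗ[ℂ] (HTensor H K →L[ℂ] HTensor H' K') :=
  LinearMap.mk₂ ℂ map
    (fun _ _ _ => ext fun h k => by simp [map_tmul, add_tmul])
    (fun _ _ _ => ext fun h k => by simp [map_tmul, smul_tmul])
    (fun _ _ _ => ext fun h k => by simp [map_tmul, tmul_add])
    (fun _ _ _ => ext fun h k => by simp [map_tmul, tmul_smul])

theorem mapBilin_apply (S : H →L[ℂ] H') (T : K →L[ℂ] K') : mapBilin S T = map S T := rfl

theorem map_smul_left (c : ℂ) (S : H →L[ℂ] H') (T : K →L[ℂ] K') :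
    map (c • S) T = c • map S T := by
  rw [← mapBilin_apply, map_smul]; rfl

theorem map_smul_right (c : ℂ) (S : H →L[ℂ] H') (T : K →L[ℂ] K') :
    map S (c • T) = c • map S T := by
  rw [← mapBilin_apply, map_smul]; rfl

theorem map_add_left (S S' : H →L[ℂ] H') (T : K →L[ℂ] K') :
    map (S + S') T = map S T + map S' T := by
  rw [← mapBilin_apply, map_add]; rfl

theorem map_zero_left (T : K →L[ℂ] K') : map (0 : H →L[ℂ] H') T = 0 := by
  rw [← mapBilin_apply, map_zero]; rfl

theorem map_zero_right (S : H →L[ℂ] H') : map S (0 : K →L[ℂ] K') = 0 := by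
  rw [← mapBilin_apply, map_zero]

theorem map_sum_left {ι : Type*} (s : Finset ι) (S : ι → H →L[ℂ] H') (T : K →L[ℂ] K') :
    map (∑ i ∈ s, S i) T = ∑ i ∈ s, map (S i) T := by
  rw [← mapBilin_apply, map_sum, LinearMap.sum_apply]; rfl

theorem map_sum_right {ι : Type*} (s : Finset ι) (S : H →L[ℂ] H') (T : ι → K →L[ℂ] K') :
    map S (∑ i ∈ s, T i) = ∑ i ∈ s, map S (T i) := by
  rw [← mapBilin_apply, map_sum]; rfl

/-- Two vectors of the algebraic tensor product are fixed by `1 ⊗ P` for the projection `P` onto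
some finite-dimensional subspace of the second factor. -/
theorem exists_finiteDimensional_fixed (z z' : H ⊗[ℂ] K) :
    ∃ (V : Submodule ℂ K) (_ : FiniteDimensional ℂ V),
      map (ContinuousLinearMap.id ℂ H) V.starProjection (of z) = of z ∧
      map (ContinuousLinearMap.id ℂ H) V.starProjection (of z') = of z' := by
  obtain ⟨E, V, hE, hV, hz⟩ := TensorProduct.exists_finite_submodule_of_setFinite {z, z'}
    (Set.toFinite _)
  have key : ∀ y : E ⊗[ℂ] V, map (ContinuousLinearMap.id ℂ H) V.starProjection
      (of (TensorProduct.mapIncl E V y)) = of (TensorProduct.mapIncl E V y) := fun y => by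
    induction y with
    | zero => simp
    | add x y hx hy => rw [map_add, map_add, map_add, hx, hy]
    | tmul a b =>
      rw [TensorProduct.mapIncl, TensorProduct.map_tmul]
      refine (map_tmul _ _ _ _).trans ?_
      simp [tmul, Submodule.starProjection_eq_self_iff.2 b.2]
  refine ⟨V, hV, ?_, ?_⟩
  · obtain ⟨y, rfl⟩ := hz (Set.mem_insert _ _)
    exact key y
  · obtain ⟨y, rfl⟩ := hz (Set.mem_insert_of_mem _ rfl)
    exact key y

end HTensor

/-! ### The minimal norm and jointly faithful families of representations -/

namespace HilbertRep

open InnerProductSpace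

variable {A C : Type u} [NonUnitalCStarAlgebra A] [NonUnitalCStarAlgebra C]

section coeffMatrix

variable {n : Type}

/-- The matrix `((id ⊗ ω_{k,l})(t))`, where `ω_{k,l}(c) = ⟪e_k, σ(c) e_l⟫`. -/
def coeffMatrix (σ : HilbertRep C) (e : n → σ.H) : A ⊗[ℂ] C →ₗ[ℂ] CStarMatrix n n A :=
  TensorProduct.lift (LinearMap.mk₂ ℂ
    (fun a c => CStarMatrix.ofMatrix fun k l => inner ℂ (e k) (σ.π c (e l)) • a)
    (fun a a' c => CStarMatrix.ext fun k l => smul_add _ a a')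
    (fun z a c => CStarMatrix.ext fun k l => smul_comm _ z a)
    (fun a c c' => CStarMatrix.ext fun k l => by
      simp only [map_add, add_apply, inner_add_right, add_smul]; rfl)
    (fun z a c => CStarMatrix.ext fun k l => by
      simp only [map_smul, smul_apply, inner_smul_right, mul_smul]; rfl))

theorem coeffMatrix_tmul (σ : HilbertRep C) (e : n → σ.H) (a : A) (c : C) (k l : n) :
    coeffMatrix σ e (a ⊗ₜ[ℂ] c) k l = inner ℂ (e k) (σ.π c (e l)) • a := rfl

end coeffMatrix

section amplify

attribute [local instance] CStarAlgebra.spectralOrder CStarAlgebra.spectralOrderedRing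

variable {K : Type u} [NormedAddCommGroup K] [InnerProductSpace ℂ K] [CompleteSpace K]
  {n : Type} [Fintype n] [DecidableEq n]

/-- The amplification of a representation of `A` on `H` to the matrix algebra over `A`. The matrix
units are realized by the rank one operators of an orthonormal family in `K`, so the
representation space is `H ⊗ K`. -/
def amplify (ρ : HilbertRep A) {e : n → K} (he : Orthonormal ℂ e) :
    CStarMatrix n n A →⋆ₙₐ[ℂ] (HTensor ρ.H K →L[ℂ] HTensor ρ.H K) where
  toFun M := ∑ k, ∑ l, HTensor.map (ρ.π (M k l)) (rankOne ℂ (e k) (e l))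
  map_smul' c M := by
    simp [Finset.smul_sum, HTensor.map_smul_left]
  map_zero' := by simp [HTensor.map_zero_left]
  map_add' M N := by simp [HTensor.map_add_left, Finset.sum_add_distrib]
  map_mul' M N := by
    have h : ∀ k l i j, HTensor.map (ρ.π (M k l)) (rankOne ℂ (e k) (e l)) *
        HTensor.map (ρ.π (N i j)) (rankOne ℂ (e i) (e j)) =
        if l = i then HTensor.map (ρ.π (M k l * N i j)) (rankOne ℂ (e k) (e j)) else 0 := by
      intro k l i j
      rw [HTensor.map_mul_map, ← map_mul, ContinuousLinearMap.mul_def (rankOne ℂ (e k) (e l)),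
        rankOne_comp_rankOne, orthonormal_iff_ite.1 he]
      split_ifs <;> simp [HTensor.map_zero_right]
    simp_rw [Finset.sum_mul, Finset.mul_sum, h]
    refine Finset.sum_congr rfl fun k _ => ?_
    simp_rw [CStarMatrix.mul_apply, map_sum, HTensor.map_sum_left]
    rw [Finset.sum_comm]
    refine Finset.sum_congr rfl fun l _ => ?_
    symm
    rw [Finset.sum_eq_single l (by intro i _ hi; simp [hi.symm]) (by simp)]
    simp
  map_star' M := by
    simp_rw [ContinuousLinearMap.star_eq_adjoint, map_sum, ← HTensor.adjoint_map,
      adjoint_rankOne, ← ContinuousLinearMap.star_eq_adjoint, ← map_star]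
    rw [Finset.sum_comm]
    rfl

theorem amplify_apply (ρ : HilbertRep A) {e : n → K} (he : Orthonormal ℂ e)
    (M : CStarMatrix n n A) :
    ρ.amplify he M = ∑ k, ∑ l, HTensor.map (ρ.π (M k l)) (rankOne ℂ (e k) (e l)) := rfl

theorem amplify_apply_tmul (ρ : HilbertRep A) {e : n → K} (he : Orthonormal ℂ e)
    (M : CStarMatrix n n A) (h : ρ.H) (l : n) :
    ρ.amplify he M (HTensor.tmul h (e l)) = ∑ k, HTensor.tmul (ρ.π (M k l) h) (e k) := by
  rw [amplify_apply, sum_apply]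
  refine Finset.sum_congr rfl fun k _ => ?_
  rw [sum_apply, Finset.sum_eq_single l]
  · rw [HTensor.map_tmul, rankOne_apply, orthonormal_iff_ite.1 he, if_pos rfl, one_smul]
  · intro j _ hj
    rw [HTensor.map_tmul, rankOne_apply, orthonormal_iff_ite.1 he, if_neg hj, zero_smul,
      HTensor.tmul, TensorProduct.tmul_zero, map_zero]
  · simp

/-- Matrix entries are recovered by compression with the vectors of the orthonormal family, so
amplification preserves joint faithfulness. -/
theorem apply_eq_zero_of_amplify_eq_zero (ρ : HilbertRep A) {e : n → K} (he : Orthonormal ℂ e)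
    {M : CStarMatrix n n A} (hM : ρ.amplify he M = 0) (k l : n) : ρ.π (M k l) = 0 := by
  ext h
  have h1 := congrArg (fun v => inner ℂ (HTensor.tmul (ρ.π (M k l) h) (e k)) v)
    (ρ.amplify_apply_tmul he M h l)
  simp only [hM, zero_apply, inner_zero_right, inner_sum,
    HTensor.inner_tmul, orthonormal_iff_ite.1 he] at h1
  simpa using h1.symm

/-- A jointly faithful family of representations computes the norm of matrices over `A`: an
injective `*`-homomorphism of C*-algebras is isometric. -/
theorem norm_matrix_le {ι : Type v} (r : ι → HilbertRep A)
    (hr : ∀ a, (∀ i, (r i).π a = 0) → a = 0) {e : n → K} (he : Orthonormal ℂ e)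
    (M : CStarMatrix n n A) {b : ℝ} (hb : 0 ≤ b) (h : ∀ i, ‖(r i).amplify he M‖ ≤ b) :
    ‖M‖ ≤ b := by
  have hbdd : ∀ M : CStarMatrix n n A, Memℓp (fun i => (r i).amplify he M) ∞ := fun M =>
    memℓp_infty ⟨‖M‖, by
      rintro _ ⟨i, rfl⟩; exact NonUnitalStarAlgHom.norm_apply_le ((r i).amplify he) M⟩
  let Φ : CStarMatrix n n A →⋆ₙₐ[ℂ]
      lp (fun i => HTensor (r i).H K →L[ℂ] HTensor (r i).H K) ∞ :=
    { toFun := fun M => ⟨fun i => (r i).amplify he M, hbdd M⟩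
      map_smul' := fun c M => lp.ext (funext fun i => map_smul ((r i).amplify he) c M)
      map_zero' := lp.ext (funext fun i => map_zero ((r i).amplify he))
      map_add' := fun M N => lp.ext (funext fun i => map_add ((r i).amplify he) M N)
      map_mul' := fun M N => lp.ext (funext fun i => map_mul ((r i).amplify he) M N)
      map_star' := fun M => lp.ext (funext fun i => map_star ((r i).amplify he) M) }
  have hΦ : Function.Injective Φ := by
    refine (injective_iff_map_eq_zero Φ).2 fun M hM => ?_
    ext k l
    refine hr _ fun i => (r i).apply_eq_zero_of_amplify_eq_zero he ?_ k l
    exact congrFun (congrArg Subtype.val hM) i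
  rw [← NonUnitalStarAlgHom.norm_map Φ hΦ M]
  exact lp.norm_le_of_forall_le hb h

/-- The compression of `(ρ ⊗ σ)(t)` by `1 ⊗ P`, where `P` is the projection onto the span of the
orthonormal family, is the image of a matrix over `A` that does not depend on `ρ`. -/
theorem amplify_coeffMatrix (ρ : HilbertRep A) (σ : HilbertRep C) {e : n → σ.H}
    (he : Orthonormal ℂ e) (t : A ⊗[ℂ] C) :
    ρ.amplify he (coeffMatrix σ e t) =
      HTensor.map (ContinuousLinearMap.id ℂ ρ.H) (∑ k, rankOne ℂ (e k) (e k)) *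
        ρ.tensor σ t *
        HTensor.map (ContinuousLinearMap.id ℂ ρ.H) (∑ k, rankOne ℂ (e k) (e k)) := by
  induction t with
  | zero => simp
  | add x y hx hy => rw [map_add, map_add, hx, hy, map_add, mul_add, add_mul]
  | tmul a c =>
    rw [amplify_apply, tensor_tmul, HTensor.map_mul_map, HTensor.map_mul_map]
    have h : (∑ k, rankOne ℂ (e k) (e k)) * σ.π c * (∑ k, rankOne ℂ (e k) (e k)) =
        ∑ k, ∑ l, inner ℂ (e k) (σ.π c (e l)) • rankOne ℂ (e k) (e l) := by
      simp_rw [Finset.sum_mul, Finset.mul_sum]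
      refine Finset.sum_congr rfl fun k _ => Finset.sum_congr rfl fun l _ => ?_
      ext x
      simp only [mul_apply_eq_comp, rankOne_apply, smul_apply, map_smul,
        smul_smul]
      rw [mul_comm]
    rw [h, HTensor.map_sum_right]
    refine Finset.sum_congr rfl fun k _ => ?_
    rw [HTensor.map_sum_right]
    refine Finset.sum_congr rfl fun l _ => ?_
    rw [coeffMatrix_tmul, map_smul, HTensor.map_smul_left, HTensor.map_smul_right]
    rfl

end amplify

/-- The image of an algebraic vector is algebraic. -/
theorem exists_tensor_of (ρ : HilbertRep A) (σ : HilbertRep C) (t : A ⊗[ℂ] C)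
    (z : ρ.H ⊗[ℂ] σ.H) : ∃ z', ρ.tensor σ t (HTensor.of z) = HTensor.of z' := by
  induction t with
  | zero => exact ⟨0, by simp⟩
  | add x y hx hy =>
    obtain ⟨x', hx⟩ := hx
    obtain ⟨y', hy⟩ := hy
    exact ⟨x' + y', by rw [map_add, add_apply, hx, hy, map_add]⟩
  | tmul a c => exact ⟨_, HTensor.map_of _ _ z⟩

/-- In the minimal norm it suffices to take representations of the first factor from a jointly
faithful family. -/
theorem norm_tensor_le_of_forall {ι : Type v} (r : ι → HilbertRep A)
    (hr : ∀ a, (∀ i, (r i).π a = 0) → a = 0) (ρ : HilbertRep A) (σ : HilbertRep C)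
    (t : A ⊗[ℂ] C) {b : ℝ} (hb : 0 ≤ b) (h : ∀ i, ‖(r i).tensor σ t‖ ≤ b) :
    ‖ρ.tensor σ t‖ ≤ b := by
  refine ContinuousLinearMap.opNorm_le_bound _ hb fun ξ => ?_
  refine HTensor.denseRange_of.induction_on ξ (isClosed_le (by fun_prop) (by fun_prop)) fun z => ?_
  obtain ⟨z', hz'⟩ := ρ.exists_tensor_of σ t z
  obtain ⟨V, hV, h1, h2⟩ := HTensor.exists_finiteDimensional_fixed z z'
  have he : Orthonormal ℂ fun k => (stdOrthonormalBasis ℂ V k : σ.H) :=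
    (stdOrthonormalBasis ℂ V).orthonormal.comp_linearIsometry V.subtypeₗᵢ
  have hP : ∑ k, rankOne ℂ (stdOrthonormalBasis ℂ V k : σ.H) (stdOrthonormalBasis ℂ V k : σ.H) =
      V.starProjection :=
    ((stdOrthonormalBasis ℂ V).starProjection_eq_sum_rankOne).symm
  have hcomp := fun τ : HilbertRep A => τ.amplify_coeffMatrix σ he t
  simp only [hP] at hcomp
  have hone : ∀ τ : HilbertRep A,
      ‖HTensor.map (ContinuousLinearMap.id ℂ τ.H) V.starProjection‖ ≤ 1 := fun τ =>
    (HTensor.norm_map_le _ _).trans (mul_le_one₀ ContinuousLinearMap.norm_id_le (norm_nonneg _)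
      V.starProjection_norm_le)
  -- The C*-norm on matrices is defined through an order on `A`.
  let := CStarAlgebra.spectralOrder A
  have := CStarAlgebra.spectralOrderedRing A
  have hM : ‖coeffMatrix (A := A) σ (fun k => (stdOrthonormalBasis ℂ V k : σ.H)) t‖ ≤ b := by
    refine norm_matrix_le r hr he _ hb fun i => ?_
    rw [hcomp]
    refine (norm_mul_le _ _).trans (mul_le_of_le_one_right (norm_nonneg _) (hone _) |>.trans ?_)
    exact (norm_mul_le _ _).trans
      ((mul_le_of_le_one_left (norm_nonneg _) (hone _)).trans (h i))
  -- Both `z` and its image are fixed by `1 ⊗ P`, so on `z` the operator is its compression.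
  have h3 : ρ.tensor σ t (HTensor.of z) = ρ.amplify he 
      (coeffMatrix σ (fun k => (stdOrthonormalBasis ℂ V k : σ.H)) t) (HTensor.of z) := by
    rw [hcomp, mul_apply_eq_comp, mul_apply_eq_comp, h1, hz', h2]
  rw [h3]
  exact (ContinuousLinearMap.le_opNorm _ _).trans (mul_le_mul_of_nonneg_right
    ((NonUnitalStarAlgHom.norm_apply_le (ρ.amplify he) _).trans hM) (norm_nonneg _))

end HilbertRep

/-! ### Completions and dense `*`-homomorphisms -/

namespace CStarSeminorm

variable {𝔄 : Type u} [NonUnitalRing 𝔄] [StarRing 𝔄] [Module ℂ 𝔄]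
  {X : Type v} [NonUnitalCStarAlgebra X] {Y : Type w} [NonUnitalCStarAlgebra Y]

/-- The C*-seminorm `a ↦ ‖j a‖` of a `*`-homomorphism `j` into a C*-algebra. -/
def ofHom (j : 𝔄 →⋆ₙₐ[ℂ] X) : CStarSeminorm 𝔄 :=
  ofHoms (fun _ : Unit => j) fun x => ⟨‖j x‖, fun _ => le_rfl⟩

theorem ofHom_apply (j : 𝔄 →⋆ₙₐ[ℂ] X) (a : 𝔄) : (ofHom j).toSeminorm a = ‖j a‖ :=
  (ofHoms_apply _ _ _).trans ciSup_const

variable [StarModule ℂ 𝔄] [IsScalarTower ℂ 𝔄 𝔄] [SMulCommClass ℂ 𝔄 𝔄]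

/-- A `*`-homomorphism with dense range identifies its target with the completion of its domain
for the norm of the target. -/
theorem bijective_lift_ofHom (j : 𝔄 →⋆ₙₐ[ℂ] X) (hj : DenseRange j) :
    Function.Bijective (lift (p := ofHom j) j fun a => (ofHom_apply j a).ge) := by
  set L := lift (p := ofHom j) j fun a => (ofHom_apply j a).ge
  have hL : ∀ a, L ((ofHom j).toCompl a) = j a := lift_toCompl j _
  have hc : Continuous L := continuous_starHom L
  have hiso : Isometry L := AddMonoidHomClass.isometry_of_norm L fun x =>
    induction_on (q := fun x => ‖L x‖ = ‖x‖) x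
      (isClosed_eq hc.norm continuous_norm) fun a =>
        (congrArg norm (hL a)).trans ((ofHom_apply j a).symm.trans (norm_toCompl _ a).symm)
  refine ⟨hiso.injective, Set.range_eq_univ.1 ?_⟩
  rw [← hiso.isClosedEmbedding.isClosed_range.closure_eq]
  refine (hj.mono ?_).closure_eq
  rintro _ ⟨a, rfl⟩
  exact ⟨_, hL a⟩

theorem exists_starHom_of_norm_le (j : 𝔄 →⋆ₙₐ[ℂ] X) (hj : DenseRange j) (f : 𝔄 →⋆ₙₐ[ℂ] Y)
    (hf : ∀ a, ‖f a‖ ≤ ‖j a‖) : ∃ g : X →⋆ₙₐ[ℂ] Y, ∀ a, g (j a) = f a := by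
  let e := StarAlgEquiv.ofBijective _ (bijective_lift_ofHom j hj)
  have he : ∀ a, e.symm (j a) = (ofHom j).toCompl a := fun a => by
    rw [← e.symm_apply_apply ((ofHom j).toCompl a)]
    exact congrArg e.symm (lift_toCompl j (fun a => (ofHom_apply j a).ge) a).symm
  have hf' : ∀ a, ‖f a‖ ≤ (ofHom j).toSeminorm a := fun a => (hf a).trans (ofHom_apply j a).ge
  refine ⟨(lift f hf').comp (e.symm : X →⋆ₙₐ[ℂ] (ofHom j).Compl), fun a => ?_⟩
  exact (congrArg (lift f hf') (he a)).trans (lift_toCompl f hf' a)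

theorem exists_starAlgEquiv_of_norm_eq (j : 𝔄 →⋆ₙₐ[ℂ] X) (hj : DenseRange j) (k : 𝔄 →⋆ₙₐ[ℂ] Y)
    (hk : DenseRange k) (h : ∀ a, ‖j a‖ = ‖k a‖) :
    ∃ α : X ≃⋆ₐ[ℂ] Y, ∀ a, α (j a) = k a := by
  obtain ⟨g, hg⟩ := exists_starHom_of_norm_le j hj k fun a => (h a).ge
  obtain ⟨g', hg'⟩ := exists_starHom_of_norm_le k hk j fun a => (h a).le
  have h1 : ∀ x, g' (g x) = x := fun x => congrFun (hj.equalizer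
    ((continuous_starHom g').comp (continuous_starHom g)) continuous_id
    (funext fun a => by simp [hg, hg'])) x
  have h2 : ∀ y, g (g' y) = y := fun y => congrFun (hk.equalizer
    ((continuous_starHom g).comp (continuous_starHom g')) continuous_id
    (funext fun a => by simp [hg, hg'])) y
  exact ⟨StarAlgEquiv.ofBijective g
    ⟨Function.LeftInverse.injective h1, Function.RightInverse.surjective h2⟩, hg⟩

end CStarSeminorm

/-- Two operators that restrict to the same operator on a space `W`, embedded in both spaces with
the same norm and densely in the first, compare in norm. -/
theorem opNorm_le_of_intertwining {W : Type*} {X Y : Type*} [NormedAddCommGroup X]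
    [NormedSpace ℂ X] [NormedAddCommGroup Y] [NormedSpace ℂ Y] {jX : W → X} (hX : DenseRange jX)
    {jY : W → Y} (hj : ∀ w, ‖jX w‖ = ‖jY w‖) (S : X →L[ℂ] X) (T : Y →L[ℂ] Y)
    (h : ∀ w, ∃ w', S (jX w) = jX w' ∧ T (jY w) = jY w') : ‖S‖ ≤ ‖T‖ := by
  refine ContinuousLinearMap.opNorm_le_bound _ (norm_nonneg _) fun x => ?_
  refine hX.induction_on x (isClosed_le (by fun_prop) (by fun_prop)) fun w => ?_
  obtain ⟨w', h1, h2⟩ := h w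
  rw [h1, hj, hj, ← h2]
  exact T.le_opNorm _

/-! ### Triple tensor products of Hilbert spaces -/

namespace HTensor

variable {H K L : Type u} [NormedAddCommGroup H] [InnerProductSpace ℂ H]
  [NormedAddCommGroup K] [InnerProductSpace ℂ K] [NormedAddCommGroup L] [InnerProductSpace ℂ L]

theorem continuous_tmul : Continuous fun q : H × K => tmul q.1 q.2 :=
  of.continuous.comp TensorProduct.continuous_tmul

/-- A subspace of the Hilbert space tensor product is dense if its closure contains the elementary
tensors. -/
theorem dense_of_tmul_mem (S : Submodule ℂ (HTensor H K))
    (h : ∀ x y, tmul x y ∈ closure (S : Set (HTensor H K))) : Dense (S : Set (HTensor H K)) := by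
  have h1 : ∀ t : H ⊗[ℂ] K, of t ∈ S.topologicalClosure := fun t => by
    induction t with
    | zero => rw [map_zero]; exact zero_mem _
    | add x y hx hy => rw [map_add]; exact add_mem hx hy
    | tmul x y => exact h x y
  intro z
  exact denseRange_of.induction_on z isClosed_closure h1

section assoc

variable {E F : Type u} [NormedAddCommGroup E] [InnerProductSpace ℂ E]
  [NormedAddCommGroup F] [InnerProductSpace ℂ F]

/-- The inclusion of `(H ⊙ K) ⊙ L` in `E ⊗ L`, where `E` is a completion of `H ⊙ K`. -/
def ofLeft (L : Type u) [NormedAddCommGroup L] [InnerProductSpace ℂ L] (u : H ⊗[ℂ] K →ₗᵢ[ℂ] E) :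
    (H ⊗[ℂ] K) ⊗[ℂ] L →ₗᵢ[ℂ] HTensor E L :=
  of.comp (LinearIsometry.rTensor L u)

theorem ofLeft_tmul (u : H ⊗[ℂ] K →ₗᵢ[ℂ] E) (z : H ⊗[ℂ] K) (l : L) :
    ofLeft L u (z ⊗ₜ[ℂ] l) = tmul (u z) l := rfl

/-- The inclusion of `(H ⊙ K) ⊙ L`, reassociated, in `H ⊗ F`, where `F` is a completion of
`K ⊙ L`. -/
def ofRight (H : Type u) [NormedAddCommGroup H] [InnerProductSpace ℂ H] (u : K ⊗[ℂ] L →ₗᵢ[ℂ] F) :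
    (H ⊗[ℂ] K) ⊗[ℂ] L →ₗᵢ[ℂ] HTensor H F :=
  (of.comp (LinearIsometry.lTensor H u)).comp
    (TensorProduct.assocIsometry ℂ H K L).toLinearIsometry

theorem ofRight_tmul (u : K ⊗[ℂ] L →ₗᵢ[ℂ] F) (h : H) (k : K) (l : L) :
    ofRight H u ((h ⊗ₜ[ℂ] k) ⊗ₜ[ℂ] l) = tmul h (u (k ⊗ₜ l)) := rfl

theorem denseRange_ofLeft {u : H ⊗[ℂ] K →ₗᵢ[ℂ] E} (hu : DenseRange u) :
    DenseRange (ofLeft L u) := by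
  refine dense_of_tmul_mem (LinearMap.range (ofLeft L u).toLinearMap) fun x l => ?_
  refine hu.induction_on x (isClosed_closure.preimage
    (continuous_tmul.comp (Continuous.prodMk_left l))) fun z => subset_closure ⟨z ⊗ₜ l, rfl⟩

theorem denseRange_ofRight {u : K ⊗[ℂ] L →ₗᵢ[ℂ] F} (hu : DenseRange u) :
    DenseRange (ofRight H u) := by
  refine dense_of_tmul_mem (LinearMap.range (ofRight H u).toLinearMap) fun h y => ?_
  refine hu.induction_on y (isClosed_closure.preimage
    (continuous_tmul.comp (Continuous.prodMk_right h))) fun z => ?_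
  refine subset_closure ?_
  induction z with
  | zero => simp [tmul]
  | add x y hx hy => rw [map_add, tmul_add]; exact add_mem hx hy
  | tmul k l => exact ⟨(h ⊗ₜ k) ⊗ₜ l, rfl⟩

theorem norm_ofLeft_eq (u : H ⊗[ℂ] K →ₗᵢ[ℂ] E) (v : K ⊗[ℂ] L →ₗᵢ[ℂ] F)
    (w : (H ⊗[ℂ] K) ⊗[ℂ] L) : ‖ofLeft L u w‖ = ‖ofRight H v w‖ :=
  ((ofLeft L u).norm_map w).trans ((ofRight H v).norm_map w).symm

end assoc

end HTensor

/-! ### Associativity of the minimal tensor product -/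

namespace MinTensor

variable {A B : Type u} [NonUnitalCStarAlgebra A] [NonUnitalCStarAlgebra B]

theorem norm_tensor_le (ρ : HilbertRep A) (σ : HilbertRep B) (t : A ⊗[ℂ] B) :
    ‖ρ.tensor σ t‖ ≤ ‖of A B t‖ := by
  rw [norm_of]
  exact CStarSeminorm.le_ofHoms (fun r : HilbertRep A × HilbertRep B => r.1.tensor r.2)
    HilbertRep.norm_tensor_bdd (ρ, σ) t

theorem norm_of_le {t : A ⊗[ℂ] B} {b : ℝ}
    (h : ∀ (ρ : HilbertRep A) (σ : HilbertRep B), ‖ρ.tensor σ t‖ ≤ b) : ‖of A B t‖ ≤ b := by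
  rw [norm_of]
  exact ciSup_le fun r => h r.1 r.2

theorem norm_tmul_le (a : A) (b : B) : ‖a ⊗ₑ b‖ ≤ ‖a‖ * ‖b‖ :=
  norm_of_le fun _ _ => (HTensor.norm_map_le _ _).trans
    (mul_le_mul (NonUnitalStarAlgHom.norm_apply_le _ _) (NonUnitalStarAlgHom.norm_apply_le _ _)
      (norm_nonneg _) (norm_nonneg _))

/-- The elementary tensor, as a bilinear map. -/
def tmulBilin (A B : Type u) [NonUnitalCStarAlgebra A] [NonUnitalCStarAlgebra B] :
    A →L[ℂ] B →L[ℂ] A ⊗min B :=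
  LinearMap.mkContinuous₂ ((TensorProduct.mk ℂ A B).compr₂ (of A B : A ⊗[ℂ] B →ₗ[ℂ] A ⊗min B)) 1
    fun a b => by rw [one_mul]; exact norm_tmul_le a b

theorem tmulBilin_apply (a : A) (b : B) : tmulBilin A B a b = a ⊗ₑ b := rfl

theorem continuous_tmul_left (b : B) : Continuous fun a : A => a ⊗ₑ b :=
  ((tmulBilin A B).flip b).continuous

theorem continuous_tmul_right (a : A) : Continuous fun b : B => a ⊗ₑ b :=
  (tmulBilin A B a).continuous

/-- A subspace of the minimal tensor product is dense if its closure contains the elementary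
tensors. -/
theorem dense_of_tmul_mem (S : Submodule ℂ (A ⊗min B))
    (h : ∀ a b, a ⊗ₑ b ∈ closure (S : Set (A ⊗min B))) : Dense (S : Set (A ⊗min B)) := by
  have h1 : ∀ t : A ⊗[ℂ] B, of A B t ∈ S.topologicalClosure := fun t => by
    induction t with
    | zero => rw [map_zero]; exact zero_mem _
    | add x y hx hy => rw [map_add]; exact add_mem hx hy
    | tmul x y => exact h x y
  intro z
  exact (denseRange_of A B).induction_on z isClosed_closure h1

end MinTensor

namespace HilbertRep

variable {A B C : Type u} [NonUnitalCStarAlgebra A] [NonUnitalCStarAlgebra B]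
  [NonUnitalCStarAlgebra C]

theorem exists_tensorRep (ρ : HilbertRep A) (σ : HilbertRep B) :
    ∃ π : A ⊗min B →⋆ₙₐ[ℂ] (HTensor ρ.H σ.H →L[ℂ] HTensor ρ.H σ.H),
      ∀ t, π (MinTensor.of A B t) = ρ.tensor σ t :=
  CStarSeminorm.exists_starHom_of_norm_le (MinTensor.of A B) (MinTensor.denseRange_of A B)
    (ρ.tensor σ) (MinTensor.norm_tensor_le ρ σ)

/-- The representation `ρ ⊗ σ` of the minimal tensor product. -/
def tensorRep (ρ : HilbertRep A) (σ : HilbertRep B) : HilbertRep (A ⊗min B) where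
  H := HTensor ρ.H σ.H
  π := (exists_tensorRep ρ σ).choose

theorem tensorRep_of (ρ : HilbertRep A) (σ : HilbertRep B) (t : A ⊗[ℂ] B) :
    (ρ.tensorRep σ).π (MinTensor.of A B t) = ρ.tensor σ t :=
  (exists_tensorRep ρ σ).choose_spec t

/-- The inclusion of the algebraic tensor product of the representation spaces. -/
def tensorIncl (ρ : HilbertRep A) (σ : HilbertRep B) :
    ρ.H ⊗[ℂ] σ.H →ₗᵢ[ℂ] (ρ.tensorRep σ).H := HTensor.of

theorem denseRange_tensorIncl (ρ : HilbertRep A) (σ : HilbertRep B) :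
    DenseRange (ρ.tensorIncl σ) := HTensor.denseRange_of

theorem tensorRep_tmul (ρ : HilbertRep A) (σ : HilbertRep B) (a : A) (b : B) (h : ρ.H) (k : σ.H) :
    (ρ.tensorRep σ).π (a ⊗ₑ b) (ρ.tensorIncl σ (h ⊗ₜ k)) =
      ρ.tensorIncl σ (ρ.π a h ⊗ₜ σ.π b k) :=
  (congrArg (fun T : HTensor ρ.H σ.H →L[ℂ] HTensor ρ.H σ.H => T (HTensor.tmul h k))
    (tensorRep_of ρ σ (a ⊗ₜ b))).trans (HTensor.map_tmul _ _ _ _)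

theorem norm_tensorRep_of (ρ : HilbertRep A) (σ : HilbertRep B) (t : A ⊗[ℂ] B) :
    ‖(ρ.tensorRep σ).π (MinTensor.of A B t)‖ = ‖ρ.tensor σ t‖ :=
  congrArg (fun T : HTensor ρ.H σ.H →L[ℂ] HTensor ρ.H σ.H => ‖T‖) (tensorRep_of ρ σ t)

/-- The representations `ρ ⊗ σ` are jointly faithful on the minimal tensor product. -/
theorem eq_zero_of_tensorRep_eq_zero (z : A ⊗min B)
    (h : ∀ q : HilbertRep A × HilbertRep B, (q.1.tensorRep q.2).π z = 0) : z = 0 := by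
  by_contra hz
  obtain ⟨t, ht⟩ := (MinTensor.denseRange_of A B).exists_dist_lt z
    (half_pos (norm_pos_iff.2 hz))
  have h1 : ‖MinTensor.of A B t‖ ≤ ‖z - MinTensor.of A B t‖ := MinTensor.norm_of_le fun ρ σ => by
    have h2 := NonUnitalStarAlgHom.norm_apply_le (ρ.tensorRep σ).π (z - MinTensor.of A B t)
    rwa [map_sub, h (ρ, σ), zero_sub, norm_neg, norm_tensorRep_of] at h2
  have h2 : ‖z‖ ≤ ‖z - MinTensor.of A B t‖ + ‖MinTensor.of A B t‖ := by
    simpa using norm_add_le (z - MinTensor.of A B t) (MinTensor.of A B t)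
  rw [dist_eq_norm] at ht
  linarith

-- The representation space is used through `tensorIncl` only; unfolding it makes unification of
-- the nested completions expensive.
attribute [irreducible] tensorRep tensorIncl

/-- The roles of the two factors in the norm of `ρ ⊗ σ` can be exchanged. -/
theorem norm_tensor_comm_le (ρ : HilbertRep A) (σ : HilbertRep B) (t : A ⊗[ℂ] B) :
    ‖ρ.tensor σ t‖ ≤ ‖σ.tensor ρ (TensorProduct.comm ℂ A B t)‖ := by
  refine opNorm_le_of_intertwining HTensor.denseRange_of
    (jY := HTensor.of.comp (TensorProduct.commIsometry ℂ ρ.H σ.H).toLinearIsometry)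
    (fun w => by rw [LinearIsometry.norm_map, LinearIsometry.norm_map]) _ _ fun w => ?_
  induction t with
  | zero => exact ⟨0, by simp⟩
  | add x y hx hy =>
    obtain ⟨x', h1, h2⟩ := hx
    obtain ⟨y', h3, h4⟩ := hy
    exact ⟨x' + y', by rw [map_add, add_apply, h1, h3, map_add],
      by rw [map_add, map_add, add_apply, h2, h4, map_add]⟩
  | tmul a b =>
    refine ⟨TensorProduct.mapL (ρ.π a) (σ.π b) w, HTensor.map_of _ _ w, ?_⟩
    induction w with
    | zero => simp
    | add x y hx hy => simp only [map_add, hx, hy]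
    | tmul h k => exact HTensor.map_tmul _ _ _ _

variable (A B C) in
/-- `(A ⊙ B) ⊙ C → (A ⊗ B) ⊙ C`. -/
def inclLeft : (A ⊗[ℂ] B) ⊗[ℂ] C →ₗ[ℂ] (A ⊗min B) ⊗[ℂ] C :=
  TensorProduct.map (MinTensor.of A B : A ⊗[ℂ] B →ₗ[ℂ] A ⊗min B) LinearMap.id

variable (A B C) in
/-- `(A ⊙ B) ⊙ C ≅ A ⊙ (B ⊙ C) → A ⊙ (B ⊗ C)`. -/
def inclRight : (A ⊗[ℂ] B) ⊗[ℂ] C →ₗ[ℂ] A ⊗[ℂ] (B ⊗min C) :=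
  TensorProduct.map LinearMap.id (MinTensor.of B C : B ⊗[ℂ] C →ₗ[ℂ] B ⊗min C) ∘ₗ
    (TensorProduct.assoc ℂ A B C).toLinearMap

theorem inclLeft_tmul (a : A) (b : B) (c : C) :
    inclLeft A B C ((a ⊗ₜ b) ⊗ₜ c) = (a ⊗ₑ b) ⊗ₜ c := rfl

theorem inclRight_tmul (a : A) (b : B) (c : C) :
    inclRight A B C ((a ⊗ₜ b) ⊗ₜ c) = a ⊗ₜ (b ⊗ₑ c) := rfl

/-- The two iterated tensor products of three representations agree on the common dense subspace
`(H ⊙ K) ⊙ L`. -/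
theorem tensor_assoc_intertwining (ρ : HilbertRep A) (σ : HilbertRep B) (τ : HilbertRep C)
    (t : (A ⊗[ℂ] B) ⊗[ℂ] C) (w : (ρ.H ⊗[ℂ] σ.H) ⊗[ℂ] τ.H) :
    ∃ w', (ρ.tensorRep σ).tensor τ (inclLeft A B C t) (HTensor.ofLeft τ.H (ρ.tensorIncl σ) w) =
        HTensor.ofLeft τ.H (ρ.tensorIncl σ) w' ∧
      ρ.tensor (σ.tensorRep τ) (inclRight A B C t) (HTensor.ofRight ρ.H (σ.tensorIncl τ) w) =
        HTensor.ofRight ρ.H (σ.tensorIncl τ) w' := by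
  induction t with
  | zero => exact ⟨0, by rw [map_zero, map_zero, zero_apply, LinearIsometry.map_zero],
      by rw [map_zero, map_zero, zero_apply, LinearIsometry.map_zero]⟩
  | add x y hx hy =>
    obtain ⟨x', h1, h2⟩ := hx
    obtain ⟨y', h3, h4⟩ := hy
    exact ⟨x' + y', by rw [map_add, map_add, add_apply, h1, h3, map_add],
      by rw [map_add, map_add, add_apply, h2, h4, map_add]⟩
  | tmul s c =>
    induction s with
    | zero => exact ⟨0, 
      by rw [TensorProduct.zero_tmul, map_zero, map_zero, zero_apply, LinearIsometry.map_zero],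
      by rw [TensorProduct.zero_tmul, map_zero, map_zero, zero_apply, LinearIsometry.map_zero]⟩
    | add x y hx hy =>
      obtain ⟨x', h1, h2⟩ := hx
      obtain ⟨y', h3, h4⟩ := hy
      exact ⟨x' + y', by rw [TensorProduct.add_tmul, map_add, map_add, add_apply, h1, h3, map_add],
        by rw [TensorProduct.add_tmul, map_add, map_add, add_apply, h2, h4, map_add]⟩
    | tmul a b =>
      rw [inclLeft_tmul, inclRight_tmul, tensor_tmul, tensor_tmul]
      induction w with
      | zero => exact ⟨0, by rw [LinearIsometry.map_zero, map_zero],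
        by rw [LinearIsometry.map_zero, map_zero]⟩
      | add x y hx hy =>
        obtain ⟨x', h1, h2⟩ := hx
        obtain ⟨y', h3, h4⟩ := hy
        exact ⟨x' + y', by rw [map_add, map_add, h1, h3, map_add],
          by rw [map_add, map_add, h2, h4, map_add]⟩
      | tmul z l =>
        induction z with
        | zero => exact ⟨0, 
          by rw [TensorProduct.zero_tmul, LinearIsometry.map_zero, map_zero],
          by rw [TensorProduct.zero_tmul, LinearIsometry.map_zero, map_zero]⟩
        | add x y hx hy =>
          obtain ⟨x', h1, h2⟩ := hx
          obtain ⟨y', h3, h4⟩ := hy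
          exact ⟨x' + y', by rw [TensorProduct.add_tmul, map_add, map_add, h1, h3, map_add],
            by rw [TensorProduct.add_tmul, map_add, map_add, h2, h4, map_add]⟩
        | tmul h k =>
          refine ⟨(ρ.π a h ⊗ₜ σ.π b k) ⊗ₜ τ.π c l, ?_, ?_⟩
          · rw [HTensor.ofLeft_tmul, HTensor.ofLeft_tmul, HTensor.map_tmul, tensorRep_tmul]
          · rw [HTensor.ofRight_tmul, HTensor.ofRight_tmul, HTensor.map_tmul, tensorRep_tmul]

theorem norm_tensor_assoc (ρ : HilbertRep A) (σ : HilbertRep B) (τ : HilbertRep C)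
    (t : (A ⊗[ℂ] B) ⊗[ℂ] C) :
    ‖(ρ.tensorRep σ).tensor τ (inclLeft A B C t)‖ =
      ‖ρ.tensor (σ.tensorRep τ) (inclRight A B C t)‖ := by
  have h := tensor_assoc_intertwining ρ σ τ t
  have hn := HTensor.norm_ofLeft_eq (L := τ.H) (H := ρ.H) (ρ.tensorIncl σ) (σ.tensorIncl τ)
  exact le_antisymm
    (opNorm_le_of_intertwining (HTensor.denseRange_ofLeft (denseRange_tensorIncl ρ σ)) hn _ _ h)
    (opNorm_le_of_intertwining (HTensor.denseRange_ofRight (denseRange_tensorIncl σ τ))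
      (fun w => (hn w).symm) _ _ fun w => (h w).imp fun _ h => h.symm)

end HilbertRep

namespace MinTensor

open HilbertRep

variable (A B C : Type u) [NonUnitalCStarAlgebra A] [NonUnitalCStarAlgebra B]
  [NonUnitalCStarAlgebra C]

variable {A B C} in
/-- Both iterated minimal norms are the supremum over triples of representations. -/
theorem norm_of_inclLeft_eq (t : (A ⊗[ℂ] B) ⊗[ℂ] C) :
    ‖of (A ⊗min B) C (inclLeft A B C t)‖ = ‖of A (B ⊗min C) (inclRight A B C t)‖ := by
  refine le_antisymm (norm_of_le fun π τ => ?_) (norm_of_le fun ρ π => ?_)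
  · refine norm_tensor_le_of_forall
      (fun q : HilbertRep A × HilbertRep B => q.1.tensorRep q.2)
      eq_zero_of_tensorRep_eq_zero π τ _ (norm_nonneg _) fun q => ?_
    rw [norm_tensor_assoc]
    exact norm_tensor_le _ _ _
  · refine (norm_tensor_comm_le _ _ _).trans (norm_tensor_le_of_forall
      (fun q : HilbertRep B × HilbertRep C => q.1.tensorRep q.2)
      eq_zero_of_tensorRep_eq_zero π ρ _ (norm_nonneg _) fun q => ?_)
    refine (norm_tensor_comm_le _ _ _).trans ?_
    rw [← TensorProduct.comm_symm, LinearEquiv.symm_apply_apply, ← norm_tensor_assoc]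
    exact norm_tensor_le _ _ _

/-- A linear map on `(A ⊙ B) ⊙ C` that respects products and adjoints of elementary tensors, as a
`*`-homomorphism. -/
def starHomOfTmul {D : Type v} [NonUnitalCStarAlgebra D] (F : (A ⊗[ℂ] B) ⊗[ℂ] C →ₗ[ℂ] D)
    (hmul : ∀ (a a' : A) (b b' : B) (c c' : C), F (((a * a') ⊗ₜ (b * b')) ⊗ₜ (c * c')) =
      F ((a ⊗ₜ b) ⊗ₜ c) * F ((a' ⊗ₜ b') ⊗ₜ c'))
    (hstar : ∀ (a : A) (b : B) (c : C),
      F ((star a ⊗ₜ star b) ⊗ₜ star c) = star (F ((a ⊗ₜ b) ⊗ₜ c))) :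
    (A ⊗[ℂ] B) ⊗[ℂ] C →⋆ₙₐ[ℂ] D where
  toFun := F
  map_smul' c t := map_smul F c t
  map_zero' := map_zero F
  map_add' := map_add F
  map_mul' s t := by
    induction s with
    | zero => exact (congrArg F (zero_mul t)).trans (by rw [map_zero, zero_mul])
    | add x₁ x₂ h₁ h₂ => simp only [add_mul, map_add, h₁, h₂]
    | tmul s c =>
      induction s with
      | zero =>
        rw [TensorProduct.zero_tmul]
        exact (congrArg F (zero_mul t)).trans (by rw [map_zero, zero_mul])
      | add x₁ x₂ h₁ h₂ => simp only [add_mul, map_add, TensorProduct.add_tmul, h₁, h₂]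
      | tmul a b =>
        induction t with
        | zero => exact (congrArg F (mul_zero _)).trans (by rw [map_zero, mul_zero])
        | add x₁ x₂ h₁ h₂ => simp only [mul_add, map_add, h₁, h₂]
        | tmul s c' =>
          induction s with
          | zero =>
            rw [TensorProduct.zero_tmul]
            exact (congrArg F (mul_zero _)).trans (by rw [map_zero, mul_zero])
          | add x₁ x₂ h₁ h₂ => simp only [mul_add, map_add, TensorProduct.add_tmul, h₁, h₂]
          | tmul a' b' =>
            rw [Algebra.TensorProduct.tmul_mul_tmul, Algebra.TensorProduct.tmul_mul_tmul]
            exact hmul a a' b b' c c'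
  map_star' t := by
    induction t with
    | zero => rw [star_zero, map_zero, star_zero]
    | add x₁ x₂ h₁ h₂ => simp only [star_add, map_add, h₁, h₂]
    | tmul s c =>
      induction s with
      | zero => rw [TensorProduct.zero_tmul, star_zero, map_zero, star_zero]
      | add x₁ x₂ h₁ h₂ => simp only [star_add, map_add, TensorProduct.add_tmul, h₁, h₂]
      | tmul a b =>
        rw [TensorProduct.star_tmul, TensorProduct.star_tmul]
        exact hstar a b c

/-- The canonical map `(A ⊙ B) ⊙ C → (A ⊗ B) ⊗ C`. -/
def ofLeftₗ : (A ⊗[ℂ] B) ⊗[ℂ] C →ₗ[ℂ] (A ⊗min B) ⊗min C :=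
  (of (A ⊗min B) C : (A ⊗min B) ⊗[ℂ] C →ₗ[ℂ] (A ⊗min B) ⊗min C) ∘ₗ inclLeft A B C

/-- The canonical map `(A ⊙ B) ⊙ C → A ⊗ (B ⊗ C)`. -/
def ofRightₗ : (A ⊗[ℂ] B) ⊗[ℂ] C →ₗ[ℂ] A ⊗min (B ⊗min C) :=
  (of A (B ⊗min C) : A ⊗[ℂ] (B ⊗min C) →ₗ[ℂ] A ⊗min (B ⊗min C)) ∘ₗ inclRight A B C

theorem ofLeftₗ_tmul (a : A) (b : B) (c : C) :
    ofLeftₗ A B C ((a ⊗ₜ b) ⊗ₜ c) = (a ⊗ₑ b) ⊗ₑ c := rfl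

theorem ofRightₗ_tmul (a : A) (b : B) (c : C) :
    ofRightₗ A B C ((a ⊗ₜ b) ⊗ₜ c) = a ⊗ₑ (b ⊗ₑ c) := rfl

theorem denseRange_ofLeftₗ : DenseRange (ofLeftₗ A B C) := by
  refine dense_of_tmul_mem (LinearMap.range (ofLeftₗ A B C)) fun x c => ?_
  refine (denseRange_of A B).induction_on x
    (isClosed_closure.preimage (continuous_tmul_left c)) fun z => ?_
  exact subset_closure ⟨z ⊗ₜ c, rfl⟩

theorem denseRange_ofRightₗ : DenseRange (ofRightₗ A B C) := by
  refine dense_of_tmul_mem (LinearMap.range (ofRightₗ A B C)) fun a y => ?_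
  refine (denseRange_of B C).induction_on y
    (isClosed_closure.preimage (continuous_tmul_right a)) fun z => ?_
  refine subset_closure ?_
  induction z with
  | zero => rw [map_zero, ← tmulBilin_apply, map_zero]; exact zero_mem _
  | add x y hx hy =>
    rw [map_add, ← tmulBilin_apply, map_add]
    exact add_mem hx hy
  | tmul b c => exact ⟨(a ⊗ₜ b) ⊗ₜ c, rfl⟩

/-- The associativity isomorphism of the minimal tensor product. -/
theorem exists_assoc : ∃ α : (A ⊗min B) ⊗min C ≃⋆ₐ[ℂ] A ⊗min (B ⊗min C),
    ∀ (a : A) (b : B) (c : C), α ((a ⊗ₑ b) ⊗ₑ c) = a ⊗ₑ (b ⊗ₑ c) := by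
  let j := starHomOfTmul A B C (ofLeftₗ A B C)
    (fun a a' b b' c c' => by simp only [ofLeftₗ_tmul, tmul_mul_tmul])
    (fun a b c => by simp only [ofLeftₗ_tmul, star_tmul])
  let k := starHomOfTmul A B C (ofRightₗ A B C)
    (fun a a' b b' c c' => by simp only [ofRightₗ_tmul, tmul_mul_tmul])
    (fun a b c => by simp only [ofRightₗ_tmul, star_tmul])
  obtain ⟨α, hα⟩ := CStarSeminorm.exists_starAlgEquiv_of_norm_eq j
    (denseRange_ofLeftₗ A B C) k (denseRange_ofRightₗ A B C)
    (fun t : (A ⊗[ℂ] B) ⊗[ℂ] C => norm_of_inclLeft_eq t)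
  exact ⟨α, fun a b c => hα ((a ⊗ₜ b) ⊗ₜ c)⟩

end MinTensor

/-! ### Homomorphisms on direct sums and tensor products -/

namespace C0Sum

variable {ι : Type u} {A : ι → Type v} [∀ i, NonUnitalCStarAlgebra (A i)]

/-- A closed property that is stable under addition and holds on the summands holds on the whole
direct sum. -/
theorem induction_of {P : C0Sum A → Prop} (hP : IsClosed {x | P x}) (h0 : P 0)
    (hadd : ∀ x y, P x → P y → P (x + y)) (hof : ∀ i a, P (of A i a)) (x : C0Sum A) : P x :=
  hP.mem_of_tendsto (hasSum_of x) (Eventually.of_forall fun _ =>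
    Finset.sum_induction _ P hadd h0 fun _ _ => hof _ _)

theorem hom_ext {D : Type w} [NonUnitalCStarAlgebra D] {f g : C0Sum A →⋆ₙₐ[ℂ] D}
    (h : ∀ i a, f (of A i a) = g (of A i a)) (x : C0Sum A) : f x = g x :=
  induction_of (P := fun x => f x = g x)
    (isClosed_eq (continuous_starHom f) (continuous_starHom g))
    (by rw [map_zero, map_zero]) (fun x y hx hy => by rw [map_add, map_add, hx, hy]) h x

end C0Sum

namespace MinTensor

variable {A B A' B' A'' B'' : Type u} [NonUnitalCStarAlgebra A] [NonUnitalCStarAlgebra B]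
  [NonUnitalCStarAlgebra A'] [NonUnitalCStarAlgebra B'] [NonUnitalCStarAlgebra A'']
  [NonUnitalCStarAlgebra B'']

theorem hom_ext {D : Type v} [NonUnitalCStarAlgebra D] {f g : A ⊗min B →⋆ₙₐ[ℂ] D}
    (h : ∀ a b, f (a ⊗ₑ b) = g (a ⊗ₑ b)) (x : A ⊗min B) : f x = g x :=
  ext_of_continuous (f := (f : A ⊗min B →+ D)) (g := (g : A ⊗min B →+ D))
    (continuous_starHom f) (continuous_starHom g) h x

theorem map_map (f : A' →⋆ₙₐ[ℂ] A'') (g : B' →⋆ₙₐ[ℂ] B'') (f' : A →⋆ₙₐ[ℂ] A')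
    (g' : B →⋆ₙₐ[ℂ] B') (x : A ⊗min B) :
    map f g (map f' g' x) = map (f.comp f') (g.comp g') x :=
  hom_ext (f := (map f g).comp (map f' g')) (fun a b => by
    rw [NonUnitalStarAlgHom.comp_apply, map_tmul, map_tmul, map_tmul]; rfl) x

theorem zero_tmul (b : B) : (0 : A) ⊗ₑ b = 0 := by rw [tmul, TensorProduct.zero_tmul, map_zero]

theorem tmul_zero (a : A) : a ⊗ₑ (0 : B) = 0 := by rw [tmul, TensorProduct.tmul_zero, map_zero]

theorem add_tmul (a a' : A) (b : B) : (a + a') ⊗ₑ b = a ⊗ₑ b + a' ⊗ₑ b := by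
  rw [tmul, TensorProduct.add_tmul, map_add]; rfl

theorem tmul_add (a : A) (b b' : B) : a ⊗ₑ (b + b') = a ⊗ₑ b + a ⊗ₑ b' := by
  rw [tmul, TensorProduct.tmul_add, map_add]; rfl

theorem map_sum_left {ι : Type*} [Fintype ι] (f : A →⋆ₙₐ[ℂ] A') (F : ι → A →⋆ₙₐ[ℂ] A')
    (h : ∀ a, f a = ∑ i, F i a) (g : B →⋆ₙₐ[ℂ] B') (x : A ⊗min B) :
    map f g x = ∑ i, map (F i) g x := by
  refine (ext_of_continuous (f := (map f g : A ⊗min B →+ A' ⊗min B'))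
    (g := ∑ i, (map (F i) g : A ⊗min B →+ A' ⊗min B')) (continuous_starHom _) ?_ ?_ x).trans ?_
  · simp only [AddMonoidHom.coe_finsetSum, Finset.sum_fn]
    exact continuous_finsetSum _ fun i _ => continuous_starHom (map (F i) g)
  · intro a b
    rw [AddMonoidHom.finsetSum_apply]
    refine (map_tmul f g a b).trans ?_
    rw [h, tmul, TensorProduct.sum_tmul, map_sum]
    exact Finset.sum_congr rfl fun i _ => (map_tmul (F i) g a b).symm
  · rw [AddMonoidHom.finsetSum_apply]; rfl

theorem map_sum_right {ι : Type*} [Fintype ι] (f : A →⋆ₙₐ[ℂ] A') (g : B →⋆ₙₐ[ℂ] B')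
    (G : ι → B →⋆ₙₐ[ℂ] B') (h : ∀ b, g b = ∑ i, G i b) (x : A ⊗min B) :
    map f g x = ∑ i, map f (G i) x := by
  refine (ext_of_continuous (f := (map f g : A ⊗min B →+ A' ⊗min B'))
    (g := ∑ i, (map f (G i) : A ⊗min B →+ A' ⊗min B')) (continuous_starHom _) ?_ ?_ x).trans ?_
  · simp only [AddMonoidHom.coe_finsetSum, Finset.sum_fn]
    exact continuous_finsetSum _ fun i _ => continuous_starHom (map f (G i))
  · intro a b
    rw [AddMonoidHom.finsetSum_apply]
    refine (map_tmul f g a b).trans ?_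
    rw [h, tmul, TensorProduct.tmul_sum, map_sum]
    exact Finset.sum_congr rfl fun i _ => (map_tmul f (G i) a b).symm
  · rw [AddMonoidHom.finsetSum_apply]; rfl

/-- The inclusion `x ↦ 1 ⊗ x` of a C*-algebra in its tensor product with `ℂ`. -/
def oneTmul (A : Type) [NonUnitalCStarAlgebra A] : A →⋆ₙₐ[ℂ] ℂ ⊗min A where
  toFun x := (1 : ℂ) ⊗ₑ x
  map_smul' c x := map_smul (tmulBilin ℂ A 1) c x
  map_zero' := tmul_zero 1
  map_add' := tmul_add 1
  map_mul' x y := by rw [tmul_mul_tmul, one_mul]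
  map_star' x := by rw [star_tmul, star_one]

/-- The inclusion `x ↦ x ⊗ 1` of a C*-algebra in its tensor product with `ℂ`. -/
def tmulOne (A : Type) [NonUnitalCStarAlgebra A] : A →⋆ₙₐ[ℂ] A ⊗min ℂ where
  toFun x := x ⊗ₑ (1 : ℂ)
  map_smul' c x := map_smul ((tmulBilin A ℂ).flip 1) c x
  map_zero' := zero_tmul 1
  map_add' x y := add_tmul x y 1
  map_mul' x y := by rw [tmul_mul_tmul, one_mul]
  map_star' x := by rw [star_tmul, star_one]

end MinTensor

/-! ### The Kronecker product -/

namespace NDMatrix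

theorem ext_of_cast {A A' : NDMatrix} (h : A.size = A'.size)
    (hm : ∀ i j, A.mat i j = A'.mat (Fin.cast h i) (Fin.cast h j)) : A = A' := by
  obtain ⟨n, _, M, _, _, _⟩ := A
  obtain ⟨n', _, M', _, _, _⟩ := A'
  obtain rfl : n = n' := h
  obtain rfl : M = M' := by ext i j; exact hm i j
  rfl

/-- The row index in `B` of a row index of `B ⊠ C`. -/
def fstIdx (B C : NDMatrix) (k : Fin (B ⊠ C).size) : Fin B.size := Fin.divNat (n := C.size) k

/-- The row index in `C` of a row index of `B ⊠ C`. -/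
def sndIdx (B C : NDMatrix) (k : Fin (B ⊠ C).size) : Fin C.size := Fin.modNat (m := B.size) k

theorem kron_mat_apply (B C : NDMatrix) (k l : Fin (B ⊠ C).size) :
    (B ⊠ C).mat k l = B.mat (fstIdx B C k) (fstIdx B C l) * C.mat (sndIdx B C k) (sndIdx B C l) :=
  rfl

section index

variable {B C D : NDMatrix} (h : ((B ⊠ C) ⊠ D).size = (B ⊠ (C ⊠ D)).size)
  (k : Fin ((B ⊠ C) ⊠ D).size)

theorem fstIdx_fstIdx : fstIdx B C (fstIdx (B ⊠ C) D k) = fstIdx B (C ⊠ D) (Fin.cast h k) :=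
  Fin.ext <| by
    change (k : ℕ) / D.size / C.size = (k : ℕ) / (C.size * D.size)
    rw [Nat.div_div_eq_div_mul, mul_comm]

theorem sndIdx_fstIdx :
    sndIdx B C (fstIdx (B ⊠ C) D k) = fstIdx C D (sndIdx B (C ⊠ D) (Fin.cast h k)) :=
  Fin.ext (Nat.mod_mul_left_div_self (k : ℕ) D.size C.size).symm

theorem sndIdx_sndIdx : sndIdx (B ⊠ C) D k = sndIdx C D (sndIdx B (C ⊠ D) (Fin.cast h k)) :=
  Fin.ext (Nat.mod_mul_left_mod (k : ℕ) C.size D.size).symm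

end index

theorem kron_assoc (B C D : NDMatrix) : (B ⊠ C) ⊠ D = B ⊠ (C ⊠ D) :=
  have h : ((B ⊠ C) ⊠ D).size = (B ⊠ (C ⊠ D)).size := mul_assoc _ _ _
  ext_of_cast h fun i j => by
    simp only [kron_mat_apply, fstIdx_fstIdx h, sndIdx_fstIdx h, sndIdx_sndIdx h, mul_assoc]

theorem sndIdx_one {A : NDMatrix} (h : (one ⊠ A).size = A.size) (k : Fin (one ⊠ A).size) :
    sndIdx one A k = Fin.cast h k :=
  Fin.ext (Nat.mod_eq_of_lt (k.isLt.trans_eq h))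

theorem fstIdx_one {A : NDMatrix} (h : (A ⊠ one).size = A.size) (k : Fin (A ⊠ one).size) :
    fstIdx A one k = Fin.cast h k :=
  Fin.ext (Nat.div_one _)

theorem one_kron (A : NDMatrix) : one ⊠ A = A :=
  have h : (one ⊠ A).size = A.size := one_mul _
  ext_of_cast h fun i j => by
    rw [kron_mat_apply, sndIdx_one h, sndIdx_one h]; exact one_mul _

theorem kron_one (A : NDMatrix) : A ⊠ one = A :=
  have h : (A ⊠ one).size = A.size := mul_one _
  ext_of_cast h fun i j => by
    rw [kron_mat_apply, fstIdx_one h, fstIdx_one h]; exact mul_one _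

/-- The identity matrix of size `n + 1`. -/
def identity (n : ℕ) : NDMatrix where
  size := n + 1
  size_pos := n.succ_pos
  mat := 1
  zero_or_one i j := by rw [Matrix.one_apply]; split_ifs <;> simp
  row_ne_zero i := ⟨i, by simp⟩
  col_ne_zero i := ⟨i, by simp⟩

theorem identity_injective : Function.Injective identity := fun _ _ h =>
  Nat.succ_injective (congrArg size h)

end NDMatrix

/-! ### Homomorphisms on Cuntz-Krieger algebras -/

namespace CKAlgebra

variable {A : NDMatrix}

theorem hom_ext {D : Type v} [NonUnitalCStarAlgebra D] {f g : CKAlgebra A →⋆ₙₐ[ℂ] D}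
    (h : ∀ i, f (gen A i) = g (gen A i)) (x : CKAlgebra A) : f x = g x := by
  have h1 : f 1 = g 1 := by
    have hs : ∑ i, gen A i * star (gen A i) = 1 := (canonicalFamily A).sum_mul_star
    simp only [← hs, map_sum, map_mul, map_star, h]
  refine denseRange_ofFree.induction_on x
    (isClosed_eq (continuous_starHom f) (continuous_starHom g)) fun a => ?_
  induction a using FreeStarAlgebra.induction with
  | h_scalar r => rw [AlgHomClass.commutes, Algebra.algebraMap_eq_smul_one, map_smul, map_smul, h1]
  | h_gen x =>
    cases x with
    | inl i => exact h i
    | inr i =>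
      have : FreeStarAlgebra.gen (Sum.inr i) = star (FreeStarAlgebra.gen (Sum.inl i)) :=
        (FreeStarAlgebra.star_gen (Sum.inl i)).symm
      rw [this, map_star, map_star, map_star]
      exact congrArg star (h i)
  | h_mul a b ha hb => rw [map_mul, map_mul, map_mul, ha, hb]
  | h_add a b ha hb => rw [map_add, map_add, map_add, ha, hb]

theorem cast_gen {A' : NDMatrix} (h : A = A') (i : Fin A.size) :
    cast h (gen A i) = gen A' (Fin.cast (congrArg NDMatrix.size h) i) := by
  subst h; rfl

theorem evalOne_gen (i : Fin NDMatrix.one.size) : evalOne (gen NDMatrix.one i) = 1 :=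
  lift_gen oneFamily i

/-- The family `1, 0, …, 0` in `ℂ` is a Cuntz-Krieger family of the identity matrix. -/
def identityFamily (n : ℕ) : CKFamily (NDMatrix.identity n) ℂ where
  s := Pi.single (M := fun _ : Fin (n + 1) => ℂ) 0 1
  partial_isometry (i : Fin (n + 1)) := by
    by_cases h : i = 0 <;> simp [h]
  star_mul_self (i : Fin (n + 1)) := by
    change star (Pi.single (M := fun _ : Fin (n + 1) => ℂ) 0 1 i) *
        Pi.single (M := fun _ : Fin (n + 1) => ℂ) 0 1 i =
      ∑ j : Fin (n + 1), (1 : Matrix (Fin (n + 1)) (Fin (n + 1)) ℕ) i j •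
        (Pi.single (M := fun _ : Fin (n + 1) => ℂ) 0 1 j *
          star (Pi.single (M := fun _ : Fin (n + 1) => ℂ) 0 1 j))
    simp [Matrix.one_apply, mul_comm]
  sum_mul_star := by
    change ∑ j : Fin (n + 1), (Pi.single (M := fun _ : Fin (n + 1) => ℂ) 0 1 j *
          star (Pi.single (M := fun _ : Fin (n + 1) => ℂ) 0 1 j)) = 1
    rw [Finset.sum_eq_single 0 (fun j _ hj => by simp [hj]) (by simp)]
    simp
  eq_one h (i : Fin (n + 1)) := by
    obtain rfl : n = 0 := Nat.succ_injective h
    rw [Fin.fin_one_eq_zero i]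
    exact Pi.single_eq_same _ _

instance (n : ℕ) : Nontrivial (CKAlgebra (NDMatrix.identity n)) :=
  (lift (identityFamily n) : CKAlgebra (NDMatrix.identity n) →+* ℂ).domain_nontrivial

end CKAlgebra

open CKAlgebra

/-! ### Density, counit and absence of a unit -/

theorem phi_gen_apply (B C : NDMatrix) (k : Fin (B ⊠ C).size) :
    phi B C (gen (B ⊠ C) k) = gen B (NDMatrix.fstIdx B C k) ⊗ₑ gen C (NDMatrix.sndIdx B C k) :=
  let : CStarAlgebra (CKAlgebra B ⊗min CKAlgebra C) := MinTensor.cstarAlgebra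
  lift_gen (tensorFamily B C) k

theorem phiSum_gen (B C : NDMatrix) (k : Fin (B ⊠ C).size) :
    phiSum B C (gen (B ⊠ C) k) =
      C0Sum.of CKAlgebra B (gen B (NDMatrix.fstIdx B C k)) ⊗ₑ
        C0Sum.of CKAlgebra C (gen C (NDMatrix.sndIdx B C k)) := by
  rw [phiSum, NonUnitalStarAlgHom.comp_apply, phi_gen_apply, MinTensor.map_tmul]

theorem phiSum_one (B C : NDMatrix) :
    phiSum B C 1 = C0Sum.of CKAlgebra B 1 ⊗ₑ C0Sum.of CKAlgebra C 1 := by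
  rw [phiSum, NonUnitalStarAlgHom.comp_apply, phi_one, MinTensor.map_tmul]

theorem dense_span_comul : Dense (Submodule.span ℂ
    {z : CKSum ⊗min CKSum | ∃ a b c : CKSum, z = comul a * (b ⊗ₑ c)} : Set (CKSum ⊗min CKSum)) := by
  set S := Submodule.span ℂ {z : CKSum ⊗min CKSum | ∃ a b c : CKSum, z = comul a * (b ⊗ₑ c)}
  have hof : ∀ B C (b : CKAlgebra B) (c : CKAlgebra C),
      C0Sum.of CKAlgebra B b ⊗ₑ C0Sum.of CKAlgebra C c ∈ S := fun B C b c => by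
    -- The unit of `𝒪_{B ⊠ C}` acts as the identity on `𝒪_B ⊗ 𝒪_C`; the terms of `Δ` at other
    -- factorizations are orthogonal to it.
    refine Submodule.subset_span ⟨C0Sum.of CKAlgebra (B ⊠ C) 1, C0Sum.of CKAlgebra B b,
      C0Sum.of CKAlgebra C c, ?_⟩
    symm
    rw [comul_of, Finset.sum_mul,
      Finset.sum_eq_single (⟨(B, C), rfl⟩ : (B ⊠ C).Factorization)]
    · rw [cast_rfl, phiSum_one, MinTensor.tmul_mul_tmul, ← map_mul, ← map_mul, one_mul, one_mul]
    · intro q _ hq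
      rw [← MinTensor.map_tmul (C0Sum.of CKAlgebra B) (C0Sum.of CKAlgebra C)]
      exact MinTensor.map_of_mul_map_of (fun e => hq (Subtype.ext e)) _ _
    · exact fun h => absurd (Finset.mem_univ _) h
  have hcl : IsClosed (S.topologicalClosure : Set (CKSum ⊗min CKSum)) := isClosed_closure
  refine MinTensor.dense_of_tmul_mem S fun x y => ?_
  change x ⊗ₑ y ∈ S.topologicalClosure
  refine C0Sum.induction_of (P := fun x => x ⊗ₑ y ∈ S.topologicalClosure)
    (hcl.preimage (MinTensor.continuous_tmul_left y)) ?_ ?_ (fun B b => ?_) x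
  · rw [MinTensor.zero_tmul]; exact zero_mem _
  · intro x x' hx hx'
    rw [MinTensor.add_tmul]; exact add_mem hx hx'
  refine C0Sum.induction_of
    (P := fun y => C0Sum.of CKAlgebra B b ⊗ₑ y ∈ S.topologicalClosure)
    (hcl.preimage (MinTensor.continuous_tmul_right _)) ?_ ?_ (fun C c => ?_) y
  · rw [MinTensor.tmul_zero]; exact zero_mem _
  · intro x x' hx hx'
    rw [MinTensor.tmul_add]; exact add_mem hx hx'
  exact subset_closure (hof B C b c)

theorem isCounit_counit : IsCounit comul counit where
  left x := by
    refine C0Sum.hom_ext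
      (f := (MinTensor.map counit (NonUnitalStarAlgHom.id ℂ CKSum)).comp comul)
      (g := MinTensor.oneTmul CKSum) (fun A y => ?_) x
    refine CKAlgebra.hom_ext (f := ((MinTensor.map counit (NonUnitalStarAlgHom.id ℂ CKSum)).comp
      comul).comp (C0Sum.of CKAlgebra A))
      (g := (MinTensor.oneTmul CKSum).comp (C0Sum.of CKAlgebra A)) (fun k => ?_) y
    change MinTensor.map _ _ (comul (C0Sum.of CKAlgebra A (gen A k))) =
      (1 : ℂ) ⊗ₑ C0Sum.of CKAlgebra A (gen A k)
    have hterm : ∀ q : A.Factorization, MinTensor.map counit (NonUnitalStarAlgHom.id ℂ CKSum)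
        (phiSum q.1.1 q.1.2 (CKAlgebra.cast q.2.symm (gen A k))) =
        counit (C0Sum.of CKAlgebra q.1.1
          (gen q.1.1 (NDMatrix.fstIdx _ _ (Fin.cast (congrArg NDMatrix.size q.2.symm) k)))) ⊗ₑ
        C0Sum.of CKAlgebra q.1.2
          (gen q.1.2 (NDMatrix.sndIdx _ _ (Fin.cast (congrArg NDMatrix.size q.2.symm) k))) :=
    fun q => by
      rw [cast_gen, phiSum_gen, MinTensor.map_tmul]; rfl
    rw [comul_of, map_sum, Finset.sum_congr rfl fun q _ => hterm q, Finset.sum_eq_single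
      (⟨(NDMatrix.one, A), NDMatrix.one_kron A⟩ : A.Factorization)]
    · rw [counit_of_one, evalOne_gen]
      exact congrArg (fun i => (1 : ℂ) ⊗ₑ C0Sum.of CKAlgebra A (gen A i))
        (NDMatrix.sndIdx_one (one_mul _) _)
    · rintro ⟨⟨B, C⟩, hq⟩ _ hne
      have hB : B ≠ NDMatrix.one := by
        rintro rfl
        obtain rfl : C = A := (NDMatrix.one_kron C).symm.trans hq
        exact hne rfl
      rw [counit_of_ne _ hB, MinTensor.zero_tmul]
    · exact fun h => absurd (Finset.mem_univ _) h
  right x := by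
    refine C0Sum.hom_ext
      (f := (MinTensor.map (NonUnitalStarAlgHom.id ℂ CKSum) counit).comp comul)
      (g := MinTensor.tmulOne CKSum) (fun A y => ?_) x
    refine CKAlgebra.hom_ext (f := ((MinTensor.map (NonUnitalStarAlgHom.id ℂ CKSum) counit).comp
      comul).comp (C0Sum.of CKAlgebra A))
      (g := (MinTensor.tmulOne CKSum).comp (C0Sum.of CKAlgebra A)) (fun k => ?_) y
    change MinTensor.map _ _ (comul (C0Sum.of CKAlgebra A (gen A k))) =
      C0Sum.of CKAlgebra A (gen A k) ⊗ₑ (1 : ℂ)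
    have hterm : ∀ q : A.Factorization, MinTensor.map (NonUnitalStarAlgHom.id ℂ CKSum) counit
        (phiSum q.1.1 q.1.2 (CKAlgebra.cast q.2.symm (gen A k))) =
        C0Sum.of CKAlgebra q.1.1
          (gen q.1.1 (NDMatrix.fstIdx _ _ (Fin.cast (congrArg NDMatrix.size q.2.symm) k))) ⊗ₑ
        counit (C0Sum.of CKAlgebra q.1.2
          (gen q.1.2 (NDMatrix.sndIdx _ _ (Fin.cast (congrArg NDMatrix.size q.2.symm) k)))) :=
    fun q => by
      rw [cast_gen, phiSum_gen, MinTensor.map_tmul]; rfl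
    rw [comul_of, map_sum, Finset.sum_congr rfl fun q _ => hterm q, Finset.sum_eq_single
      (⟨(A, NDMatrix.one), NDMatrix.kron_one A⟩ : A.Factorization)]
    · rw [counit_of_one, evalOne_gen]
      exact congrArg (fun i => C0Sum.of CKAlgebra A (gen A i) ⊗ₑ (1 : ℂ))
        (NDMatrix.fstIdx_one (mul_one _) _)
    · rintro ⟨⟨B, C⟩, hq⟩ _ hne
      have hC : C ≠ NDMatrix.one := by
        rintro rfl
        obtain rfl : B = A := (NDMatrix.kron_one B).symm.trans hq
        exact hne rfl
      rw [counit_of_ne _ hC, MinTensor.tmul_zero]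
    · exact fun h => absurd (Finset.mem_univ _) h

/-- The components of a unit would be the units of the summands; at the identity matrices they have
norm `1`, which does not tend to `0`. -/
theorem not_exists_unit : ¬ ∃ e : CKSum, ∀ x : CKSum, e * x = x ∧ x * e = x := by
  rintro ⟨e, he⟩
  have h1 : ∀ A, C0Sum.proj CKAlgebra A e = 1 := fun A => by
    have h := congrArg (C0Sum.proj CKAlgebra A) (he (C0Sum.of CKAlgebra A 1)).1
    rwa [map_mul, C0Sum.proj_of_self, mul_one] at h
  have h2 := ((C0Sum.tendsto_proj e).comp
    NDMatrix.identity_injective.tendsto_cofinite)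
  have h3 : (fun A => ‖C0Sum.proj CKAlgebra A e‖) ∘ NDMatrix.identity = fun _ => (1 : ℝ) :=
    funext fun n => by rw [Function.comp_apply, h1, CStarRing.norm_one]
  rw [h3] at h2
  exact one_ne_zero (tendsto_nhds_unique tendsto_const_nhds h2)

/-! ### Coassociativity -/

section coassoc

/-- The component `𝒪_A → (𝒪_B ⊗ 𝒪_C) ⊗ 𝒪_D` of `(Δ ⊗ id) ∘ Δ` at a factorization
`A = (B ⊠ C) ⊠ D`. -/
def phiLeft {A : NDMatrix} (B C D : NDMatrix) (h : (B ⊠ C) ⊠ D = A) :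
    CKAlgebra A →⋆ₙₐ[ℂ] (CKSum ⊗min CKSum) ⊗min CKSum :=
  ((MinTensor.map (phiSum B C) (C0Sum.of CKAlgebra D)).comp (phi (B ⊠ C) D)).comp
    (CKAlgebra.cast h.symm)

/-- The component `𝒪_A → 𝒪_B ⊗ (𝒪_C ⊗ 𝒪_D)` of `(id ⊗ Δ) ∘ Δ` at a factorization
`A = B ⊠ (C ⊠ D)`. -/
def phiRight {A : NDMatrix} (B C D : NDMatrix) (h : B ⊠ (C ⊠ D) = A) :
    CKAlgebra A →⋆ₙₐ[ℂ] CKSum ⊗min (CKSum ⊗min CKSum) :=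
  ((MinTensor.map (C0Sum.of CKAlgebra B) (phiSum C D)).comp (phi B (C ⊠ D))).comp
    (CKAlgebra.cast h.symm)

/-- The components of the two iterated comultiplications agree: on a generator both are the tensor
product of the same three generators. -/
theorem assoc_phiLeft (α : (CKSum ⊗min CKSum) ⊗min CKSum ≃⋆ₐ[ℂ] CKSum ⊗min (CKSum ⊗min CKSum))
    (hα : ∀ a b c : CKSum, α ((a ⊗ₑ b) ⊗ₑ c) = a ⊗ₑ (b ⊗ₑ c)) {A : NDMatrix} (B C D : NDMatrix)
    (h : (B ⊠ C) ⊠ D = A) (h' : B ⊠ (C ⊠ D) = A) (x : CKAlgebra A) :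
    α (phiLeft B C D h x) = phiRight B C D h' x := by
  subst h
  refine CKAlgebra.hom_ext (f := (α : (CKSum ⊗min CKSum) ⊗min CKSum →⋆ₙₐ[ℂ] _).comp
    (phiLeft B C D rfl)) (g := phiRight B C D h') (fun k => ?_) x
  have hs := congrArg NDMatrix.size (NDMatrix.kron_assoc B C D)
  change α (phiLeft B C D rfl (gen ((B ⊠ C) ⊠ D) k)) = _
  rw [phiLeft, NonUnitalStarAlgHom.comp_apply, NonUnitalStarAlgHom.comp_apply, cast_rfl,
    phi_gen_apply, MinTensor.map_tmul, phiSum_gen, hα, phiRight, NonUnitalStarAlgHom.comp_apply,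
    NonUnitalStarAlgHom.comp_apply, cast_gen, phi_gen_apply, MinTensor.map_tmul, phiSum_gen,
    NDMatrix.fstIdx_fstIdx hs, NDMatrix.sndIdx_fstIdx hs, NDMatrix.sndIdx_sndIdx hs]

/-- On `𝒪_A` the map `(Δ ⊗ id) ∘ Δ` is a sum over the factorizations `A = (B ⊠ C) ⊠ D`. -/
theorem map_comul_id_comul (A : NDMatrix) (x : CKAlgebra A) :
    MinTensor.map comul (NonUnitalStarAlgHom.id ℂ CKSum) (comul (C0Sum.of CKAlgebra A x)) =
      ∑ q : (Σ q : A.Factorization, q.1.1.Factorization),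
        phiLeft q.2.1.1 q.2.1.2 q.1.1.2 (by rw [q.2.2, q.1.2]) x := by
  rw [comul_of, map_sum, Fintype.sum_sigma]
  refine Finset.sum_congr rfl fun q _ => ?_
  obtain ⟨⟨E, D⟩, rfl⟩ := q
  rw [phiSum, NonUnitalStarAlgHom.comp_apply, MinTensor.map_map]
  refine (MinTensor.map_sum_left _
    (fun p : E.Factorization => (phiSum p.1.1 p.1.2).comp (CKAlgebra.cast p.2.symm))
    (fun a => comul_of E a) _ _).trans (Finset.sum_congr rfl fun p _ => ?_)
  obtain ⟨⟨B, C⟩, rfl⟩ := p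
  rfl

/-- On `𝒪_A` the map `(id ⊗ Δ) ∘ Δ` is a sum over the factorizations `A = B ⊠ (C ⊠ D)`. -/
theorem map_id_comul_comul (A : NDMatrix) (x : CKAlgebra A) :
    MinTensor.map (NonUnitalStarAlgHom.id ℂ CKSum) comul (comul (C0Sum.of CKAlgebra A x)) =
      ∑ q : (Σ q : A.Factorization, q.1.2.Factorization),
        phiRight q.1.1.1 q.2.1.1 q.2.1.2 (by rw [q.2.2, q.1.2]) x := by
  rw [comul_of, map_sum, Fintype.sum_sigma]
  refine Finset.sum_congr rfl fun q _ => ?_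
  obtain ⟨⟨B, E⟩, rfl⟩ := q
  rw [phiSum, NonUnitalStarAlgHom.comp_apply, MinTensor.map_map]
  refine (MinTensor.map_sum_right _ _
    (fun p : E.Factorization => (phiSum p.1.1 p.1.2).comp (CKAlgebra.cast p.2.symm))
    (fun a => comul_of E a) _).trans (Finset.sum_congr rfl fun p _ => ?_)
  obtain ⟨⟨C, D⟩, rfl⟩ := p
  rfl

/-- Both sides describe the factorizations of `A` in three factors; the bijection rests on the
associativity of the Kronecker product. -/
def factorizationAssoc (A : NDMatrix) :
    (Σ q : A.Factorization, q.1.1.Factorization) ≃ (Σ q : A.Factorization, q.1.2.Factorization) where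
  toFun q := ⟨⟨(q.2.1.1, q.2.1.2 ⊠ q.1.1.2), by
    rw [← NDMatrix.kron_assoc, q.2.2, q.1.2]⟩, ⟨(q.2.1.2, q.1.1.2), rfl⟩⟩
  invFun q := ⟨⟨(q.1.1.1 ⊠ q.2.1.1, q.2.1.2), by
    rw [NDMatrix.kron_assoc, q.2.2, q.1.2]⟩, ⟨(q.1.1.1, q.2.1.1), rfl⟩⟩
  left_inv := by
    rintro ⟨⟨⟨E, D⟩, h⟩, ⟨⟨B, C⟩, h'⟩⟩
    obtain rfl : B ⊠ C = E := h'
    rfl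
  right_inv := by
    rintro ⟨⟨⟨B, E⟩, h⟩, ⟨⟨C, D⟩, h'⟩⟩
    obtain rfl : C ⊠ D = E := h'
    rfl

theorem comul_coassoc (α : (CKSum ⊗min CKSum) ⊗min CKSum ≃⋆ₐ[ℂ] CKSum ⊗min (CKSum ⊗min CKSum))
    (hα : ∀ a b c : CKSum, α ((a ⊗ₑ b) ⊗ₑ c) = a ⊗ₑ (b ⊗ₑ c)) (x : CKSum) :
    α (MinTensor.map comul (NonUnitalStarAlgHom.id ℂ CKSum) (comul x)) =
      MinTensor.map (NonUnitalStarAlgHom.id ℂ CKSum) comul (comul x) := by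
  refine C0Sum.hom_ext (f := (α : (CKSum ⊗min CKSum) ⊗min CKSum →⋆ₙₐ[ℂ] _).comp
      ((MinTensor.map comul (NonUnitalStarAlgHom.id ℂ CKSum)).comp comul))
    (g := (MinTensor.map (NonUnitalStarAlgHom.id ℂ CKSum) comul).comp comul) (fun A y => ?_) x
  change α (MinTensor.map comul (NonUnitalStarAlgHom.id ℂ CKSum)
    (comul (C0Sum.of CKAlgebra A y))) = MinTensor.map (NonUnitalStarAlgHom.id ℂ CKSum) comul
    (comul (C0Sum.of CKAlgebra A y))
  rw [map_comul_id_comul, map_id_comul_comul, map_sum]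
  exact Fintype.sum_equiv (factorizationAssoc A) _ _ fun q => assoc_phiLeft α hα _ _ _ _ _ y

end coassoc

theorem theorem1p1 :
    IsStrictlyProperBialgebra comul ∧ IsCounit comul counit ∧
      ¬ ∃ e : CKSum, ∀ x : CKSum, e * x = x ∧ x * e = x := by
  obtain ⟨α, hα⟩ := MinTensor.exists_assoc CKSum CKSum CKSum
  exact ⟨⟨dense_span_comul, α, hα, comul_coassoc α hα⟩, isCounit_counit, not_exists_unit⟩
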